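/- Let $F$ be a finite field and let $f(x)=x^2-rx-s\in F[x]$ be irreducible over $F$. The Hall system $H$ is $F^2$ with componentwise addition and the multiplication $$(a_1,a_2)(b_1,b_2)=\begin{cases}(a_1b_1,\;a_2b_1) & \text{if } b_2=0,\\ (a_1b_1-a_2b_2^{-1}f(b_1),\;a_1b_2-a_2b_1+a_2r) & \text{if } b_2\ne 0.\end{cases}$$ The Hall affine plane has the points $(x,y)\in H^2$ and the lines $y=xm+k$ and $x=c$ $(m,k,c\in H)$. The Hall plane is its projective completion: each parallel class (the lines of a given slope $m$, or the vertical lines) gets a common point at infinity, and the points at infinity form one further line. Six points $A_1,B_1,C_1,A_2,B_2,C_2$ define a Pappus configuration if there are points $A_3,B_3,C_3$ such that the nine points are distinct and the triples $A_1B_1C_1$, $A_2B_2C_2$, $B_1C_2A_3$, $B_2C_1A_3$, $A_1C_2B_3$, $A_2C_1B_3$, $A_1B_2C_3$, $A_2B_1C_3$, $A_3B_3C_3$ are collinear on nine distinct lines. Theorem. In the Hall plane, for every two distinct lines $\ell_1,\ell_2$ and every two distinct points $A_1,B_1$ on $\ell_1$ that are not on $\ell_2$, there are a point $C_1$ on $\ell_1$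 and points $A_2,B_2,C_2$ on $\ell_2$ such that $A_1,B_1,C_1,A_2,B_2,C_2$ define a Pappus configuration. Moreover, if $\ell_2$ is not the line at infinity and $A_1,B_1$ are affine points, then $C_1,A_2,B_2,C_2$ can be chosen to be affine points. -/

import Mathlib

namespace HallPlane

/-- Multiplication of the Hall system on `F × F` with defining polynomial
`f(x) = x ^ 2 - r * x - s`. Addition is the componentwise addition of `F × F`, and an element
`(b, 0)` plays the role of the element `b` of the basefield `F`. -/
def mul {F : Type*} [Field F] [DecidableEq F] (r s : F) (a b : F × F) : F × F :=
  if b.2 = 0 then (a.1 * b.1, a.2 * b.1)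
  else (a.1 * b.1 - a.2 * b.2⁻¹ * (b.1 ^ 2 - r * b.1 - s), a.1 * b.2 - a.2 * b.1 + a.2 * r)

/-- Points of the (projective) Hall plane: the affine points `(x, y)`, and one point at infinity
for each parallel class of lines of the Hall affine plane. -/
inductive Point (F : Type*) where
  /-- The affine point `(x, y)`. -/
  | affine (x y : F × F) : Point F
  /-- The common point at infinity of the lines of slope `m`. -/
  | slope (m : F × F) : Point F
  /-- The common point at infinity of the vertical lines. -/
  | vertical : Point F

/-- Lines of the (projective) Hall plane: the lines of the Hall affine plane and the line at
infinity. -/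
inductive Line (F : Type*) where
  /-- The line `y = x m + k` (horizontal if `m = 0`). -/
  | nonvertical (m k : F × F) : Line F
  /-- The line `x = c`. -/
  | vertical (c : F × F) : Line F
  /-- The line at infinity. -/
  | infinity : Line F

/-- A point of the Hall affine plane. -/
def Point.IsAffine {F : Type*} (P : Point F) : Prop := ∃ x y : F × F, P = Point.affine x y

/-- Incidence of points and lines in the Hall plane over the Hall system given by `r` and `s`. -/
def Incident {F : Type*} [Field F] [DecidableEq F] (r s : F) : Point F → Line F → Prop
  | .affine x y, .nonvertical m k => y = mul r s x m + k
  | .affine x _, .vertical c => x = c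
  | .affine _ _, .infinity => False
  | .slope m', .nonvertical m _ => m' = m
  | .slope _, .vertical _ => False
  | .slope _, .infinity => True
  | .vertical, .nonvertical _ _ => False
  | .vertical, .vertical _ => True
  | .vertical, .infinity => True

/-- The three points `P`, `Q`, `R` are on the line `l`. -/
def OnLine {F : Type*} [Field F] [DecidableEq F] (r s : F) (P Q R : Point F) (l : Line F) : Prop :=
  Incident r s P l ∧ Incident r s Q l ∧ Incident r s R l

/-- The six points `A₁, B₁, C₁` and `A₂, B₂, C₂` define a Pappus configuration: there are three
more points `A₃, B₃, C₃` such that the nine points are distinct and lie by threes, in the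
Pappus pattern, on nine distinct lines. -/
def IsPappus {F : Type*} [Field F] [DecidableEq F] (r s : F)
    (A₁ B₁ C₁ A₂ B₂ C₂ : Point F) : Prop :=
  ∃ A₃ B₃ C₃ : Point F, ∃ g₁ g₂ g₃ a a' b b' c c' : Line F,
    [A₁, B₁, C₁, A₂, B₂, C₂, A₃, B₃, C₃].Nodup ∧
    [g₁, g₂, g₃, a, a', b, b', c, c'].Nodup ∧
    OnLine r s A₁ B₁ C₁ g₁ ∧
    OnLine r s A₂ B₂ C₂ g₂ ∧
    OnLine r s B₁ C₂ A₃ a ∧ OnLine r s B₂ C₁ A₃ a' ∧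
    OnLine r s A₁ C₂ B₃ b ∧ OnLine r s A₂ C₁ B₃ b' ∧
    OnLine r s A₁ B₂ C₃ c ∧ OnLine r s A₂ B₁ C₃ c' ∧
    OnLine r s A₃ B₃ C₃ g₃

end HallPlane

/-! The Hall plane is a translation plane: on the four-dimensional space H × H over F, the affine
lines are the cosets of the members of a spread of planes (`component`). The vertical member and
those with slope in F fill the zero set of the quadratic form `form`, the determinant of the pair
(x, y). Each other member is spanned by v and Jv for any of its nonzero vectors v, where J (`shift r
s 0`) satisfies J² = rJ + s; on it `form` vanishes only at 0.

If the two lines are parallel, or one of them or one of the given points is at infinity, the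
configuration is written down with vector sums alone. Otherwise the lines meet in an affine point o
and the given points are o + a and o + b. It then suffices to find a hexagon with vertices
alternately on the two lines and with parallel opposite sides (`HasHexagon`): its sides meet on the
line at infinity.

Hexagons arise in three ways. `hasHexagon_of_proportional` uses parametrizations p, q of the two
components such that p + q and p + tq both map into components, for some t ≠ 0, 1.
`hasHexagon_of_commute` uses commuting linear maps that preserve every component. In characteristic
2, products of commuting maps x ↦ cx - xm give hexagons all of whose sides have slopes in F.

Each J + c is a collineation that can move a slope in F to the vertical one (`par_shift`). This
leaves three cases: the first component vertical, the second vertical with the first slope outside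
F, and both slopes outside F. In the last, u ↦ span of u, Ju supplies p and q, once `form` is
nonzero at a + u and a + cu (`exists_form_add_ne_zero`). Over the field with two elements there is
no t, but H is the field of order 4 and its scalars commute. -/

namespace HallPlane

/-! ### Points as position vectors and directions -/

section Points

variable {F : Type*}

/-- The affine point with position vector `v`. -/
def pt (v : (F × F) × (F × F)) : Point F := .affine v.1 v.2

/-- The point at infinity of a direction. -/
def inf : Option (F × F) → Point F
  | none => .vertical
  | some m => .slope m

theorem point_cases (P : Point F) : (∃ v, P = pt v) ∨ ∃ d, P = inf d := by
  rcases P with ⟨x, y⟩ | m | _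
  · exact .inl ⟨(x, y), rfl⟩
  · exact .inr ⟨some m, rfl⟩
  · exact .inr ⟨none, rfl⟩

theorem isAffine_pt (v : (F × F) × (F × F)) : (pt v).IsAffine := ⟨_, _, rfl⟩

theorem not_isAffine_inf (d : Option (F × F)) : ¬ (inf d).IsAffine := by
  rcases d with _ | m <;> rintro ⟨x, y, h⟩ <;> cases h

theorem pt_ne_inf (v : (F × F) × (F × F)) (d : Option (F × F)) : pt v ≠ inf d := fun h =>
  not_isAffine_inf d (h ▸ isAffine_pt v)

theorem pt_injective : Function.Injective (pt : (F × F) × (F × F) → Point F) := by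
  rintro ⟨x, y⟩ ⟨x', y'⟩ h
  cases h
  rfl

theorem inf_injective : Function.Injective (inf : Option (F × F) → Point F) := by
  rintro (_ | m) (_ | n) h <;> cases h <;> rfl

end Points

/-! ### The map J, the quadratic form and linear algebra over F -/

section Forms

variable {F : Type*} [Field F] {r s : F}

variable (r s) in
/-- The defining polynomial has no root in the basefield. -/
def NoRoot : Prop := ∀ x : F, x ^ 2 - r * x - s ≠ 0

theorem noRoot_of_irreducible (hf : Irreducible
    (Polynomial.X ^ 2 - Polynomial.C r * Polynomial.X - Polynomial.C s : Polynomial F)) :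
    NoRoot r s := by
  intro x hx
  have hdeg : (Polynomial.X ^ 2 - Polynomial.C r * Polynomial.X - Polynomial.C s :
      Polynomial F).natDegree = 2 := by compute_degree!
  refine hf.not_isRoot_of_natDegree_ne_one (by rw [hdeg]; norm_num) (x := x) ?_
  simpa [Polynomial.IsRoot] using hx

theorem NoRoot.form_ne_zero (hf : NoRoot r s) {x y : F} (h : ¬ (x = 0 ∧ y = 0)) :
    x ^ 2 - r * x * y - s * y ^ 2 ≠ 0 := by
  intro h0
  by_cases hy : y = 0
  · subst hy
    simp at h0
    exact h ⟨h0, rfl⟩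
  · apply hf (x / y)
    field_simp
    linear_combination h0

/-- The alternating form whose zeros are the vectors of the components of the basefield slopes. -/
def cross (x y : F × F) : F := x.1 * y.2 - x.2 * y.1

theorem exists_smul_of_cross_eq_zero {x y : F × F} (hx : x ≠ 0) (h : cross x y = 0) :
    ∃ c : F, y = c • x := by
  unfold cross at h
  by_cases h1 : x.1 = 0
  · have h2 : x.2 ≠ 0 := fun h2 => hx (Prod.ext h1 h2)
    refine ⟨y.2 / x.2, Prod.ext ?_ ?_⟩
    · simp [h1] at h ⊢; tauto
    · simp [h2]
  · refine ⟨y.1 / x.1, Prod.ext ?_ ?_⟩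
    · simp [h1]
    · simp; field_simp; linear_combination h

/-- Cramer's rule. -/
theorem eq_of_cross_ne_zero {x y : F × F} (h : cross x y ≠ 0) (z : F × F) :
    z = (cross z y / cross x y) • x + (cross x z / cross x y) • y := by
  ext <;> simp only [Prod.fst_add, Prod.snd_add, Prod.smul_fst, Prod.smul_snd, smul_eq_mul] <;>
    rw [div_mul_eq_mul_div, div_mul_eq_mul_div, ← add_div, eq_div_iff h] <;> unfold cross <;> ring

theorem exists_cross_ne_zero {x : F × F} (hx : x ≠ 0) : ∃ z, cross x z ≠ 0 := by
  by_contra! h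
  have h1 := h (1, 0)
  have h2 := h (0, 1)
  simp [cross] at h1 h2
  exact hx (Prod.ext h2 h1)

variable (r s) in
/-- The map `J + c` where `J ^ 2 = r * J + s` is the complex structure whose one-dimensional
subspaces include the components of the slopes outside the basefield. -/
def shift (c : F) : (F × F) × (F × F) →ₗ[F] (F × F) × (F × F) :=
  LinearMap.prod ((r + c) • LinearMap.fst F _ _ - LinearMap.snd F _ _)
    (c • LinearMap.snd F _ _ - s • LinearMap.fst F _ _)

theorem shift_apply (c : F) (v : (F × F) × (F × F)) :
    shift r s c v = ((r + c) • v.1 - v.2, c • v.2 - s • v.1) := rfl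

/-- Since J² = rJ + s, the product (J - r - c)(J + c) is the scalar s - rc - c² = -f(-c). It is
nonzero when f has no root, so J + c is then invertible. -/
theorem shift_shift (c : F) (v : (F × F) × (F × F)) :
    shift r s (-(r + c)) (shift r s c v) = (-((-c) ^ 2 - r * (-c) - s)) • v := by
  ext <;> simp [shift_apply] <;> ring

theorem NoRoot.shift_injective (hf : NoRoot r s) (c : F) : Function.Injective (shift r s c) := by
  intro v w h
  have h' := congrArg (shift r s (-(r + c))) h
  rw [shift_shift, shift_shift] at h'
  exact smul_right_injective _ (neg_ne_zero.2 (hf (-c))) h'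

/-- J has no eigenvalue in F, so v and Jv are independent. -/
theorem NoRoot.shift_sub_smul_ne_zero (hf : NoRoot r s) {v : (F × F) × (F × F)} (hv : v ≠ 0)
    (c : F) : shift r s 0 v - c • v ≠ 0 := by
  have h : shift r s 0 v - c • v = shift r s (-c) v := by
    ext <;> simp [shift_apply] <;> ring
  rw [h]
  exact fun h' => hv (hf.shift_injective _ (h'.trans (map_zero _).symm))

/-- The quadratic form whose nonzeros are the vectors of the slopes outside the basefield. -/
def form (v : (F × F) × (F × F)) : F := cross v.1 v.2

/-- The polar form of `form`. -/
def polar (v w : (F × F) × (F × F)) : F := cross v.1 w.2 + cross w.1 v.2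

theorem form_add_smul (v w : (F × F) × (F × F)) (t : F) :
    form (v + t • w) = form v + t * polar v w + t ^ 2 * form w := by
  simp [form, polar, cross]
  ring

variable (r s) in
/-- The linear parametrization of the line that `v` spans for the complex structure. -/
def span (v : (F × F) × (F × F)) : F × F →ₗ[F] (F × F) × (F × F) :=
  (LinearMap.fst F F F).smulRight v + (LinearMap.snd F F F).smulRight (shift r s 0 v)

theorem span_apply (v : (F × F) × (F × F)) (x : F × F) :
    span r s v x = x.1 • v + x.2 • shift r s 0 v := rfl

theorem span_add (v w : (F × F) × (F × F)) (x : F × F) :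
    span r s v x + span r s w x = span r s (v + w) x := by
  simp only [span_apply, map_add, smul_add]
  abel

theorem span_smul (v : (F × F) × (F × F)) (c : F) (x : F × F) :
    c • span r s v x = span r s (c • v) x := by
  simp only [span_apply, map_smul, smul_add, smul_comm c]

theorem NoRoot.span_injective (hf : NoRoot r s) {v : (F × F) × (F × F)} (hv : v ≠ 0) :
    Function.Injective (span r s v) := by
  rw [← LinearMap.ker_eq_bot, LinearMap.ker_eq_bot']
  intro x hx
  rw [span_apply] at hx
  have h2 : x.2 = 0 := by
    by_contra h2
    apply hf.shift_sub_smul_ne_zero hv (-(x.2⁻¹ * x.1))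
    have h := congrArg (fun u => x.2⁻¹ • u) hx
    simp only [smul_add, smul_smul, inv_mul_cancel₀ h2, one_smul, smul_zero] at h
    rw [neg_smul, sub_neg_eq_add, add_comm]
    exact h
  rw [h2, zero_smul, add_zero] at hx
  exact Prod.ext ((smul_eq_zero.1 hx).resolve_right hv) h2

/-- Over two elements, (x₁, x₂) ↦ (x₂, x₁ + x₂) permutes the three nonzero vectors cyclically. -/
theorem eq_or_eq_of_forall_eq_zero_or_one (h01 : ∀ x : F, x = 0 ∨ x = 1) {x₁ x₂ y₁ y₂ : F}
    (hx : (x₁, x₂) ≠ 0) (hy : (y₁, y₂) ≠ 0) (hxy : (x₁, x₂) ≠ (y₁, y₂)) :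
    (y₁, y₂) = (x₂, x₁ + x₂) ∨ (y₁, y₂) = (x₁ + x₂, x₂ + (x₁ + x₂)) := by
  have two : (1 + 1 : F) = 0 := (h01 _).resolve_right (by simp)
  rcases h01 x₁ with rfl | rfl <;> rcases h01 x₂ with rfl | rfl <;>
  rcases h01 y₁ with rfl | rfl <;> rcases h01 y₂ with rfl | rfl <;>
    simp [two] at hx hy hxy ⊢

theorem exists_ne_of_ne_zero_of_ne_one {t : F} (h0 : t ≠ 0) (h1 : t ≠ 1) (c c' : F) :
    ∃ a, a ≠ c ∧ a ≠ c' := by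
  by_contra! h
  by_cases h2 : (0 : F) = c
  · subst h2
    have h3 := h 1 one_ne_zero
    exact h1 ((h t h0).trans h3.symm)
  · have h3 := h 0 h2
    subst h3
    by_cases h4 : (1 : F) = c
    · exact h0 (h t (h4 ▸ h1))
    · exact one_ne_zero (h 1 h4)

end Forms

section Plane

variable {F : Type*} [Field F] [DecidableEq F] {r s : F}

/-! ### Right multiplication in the Hall system -/

theorem mul_of_snd_eq_zero (x : F × F) {m : F × F} (hm : m.2 = 0) : mul r s x m = m.1 • x := by
  ext <;> simp [mul, hm, mul_comm]

theorem mul_of_snd_ne_zero (x : F × F) {m : F × F} (hm : m.2 ≠ 0) :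
    mul r s x m = (x.1 * m.1 - x.2 * m.2⁻¹ * (m.1 ^ 2 - r * m.1 - s),
      x.1 * m.2 - x.2 * m.1 + x.2 * r) := by
  simp [mul, hm]

theorem mul_scalar (x : F × F) (c : F) : mul r s x (c, 0) = c • x :=
  mul_of_snd_eq_zero x rfl

theorem one_mul (m : F × F) : mul r s (1, 0) m = m := by
  by_cases h : m.2 = 0
  · rw [mul_of_snd_eq_zero _ h]; ext <;> simp [h]
  · rw [mul_of_snd_ne_zero _ h]; ext <;> simp

variable (r s) in
/-- Right multiplication by an element of the Hall system, as a linear map. -/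
def mulRight (m : F × F) : F × F →ₗ[F] F × F where
  toFun x := mul r s x m
  map_add' x y := by
    by_cases h : m.2 = 0
    · simp only [mul_of_snd_eq_zero _ h, smul_add]
    · simp only [mul_of_snd_ne_zero _ h]; ext <;> simp <;> ring
  map_smul' c x := by
    by_cases h : m.2 = 0
    · simp only [mul_of_snd_eq_zero _ h, smul_comm m.1, RingHom.id_apply]
    · simp only [mul_of_snd_ne_zero _ h]; ext <;> simp <;> ring

theorem mulRight_apply (m x : F × F) : mulRight r s m x = mul r s x m := rfl

/-- Every element outside the basefield is a root of the defining polynomial. -/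
theorem mul_mul_self (x : F × F) {m : F × F} (hm : m.2 ≠ 0) :
    mul r s (mul r s x m) m = r • mul r s x m + s • x := by
  simp only [mul_of_snd_ne_zero _ hm]
  ext
  · simp; field_simp; ring
  · simp; field_simp; ring

/-! ### The spread -/

variable (r s) in
/-- The components of the spread that defines the Hall plane: `none` is the vertical component and
`some m` the component of slope `m`. -/
def component : Option (F × F) → Submodule F ((F × F) × (F × F))
  | none => LinearMap.ker (LinearMap.fst F (F × F) (F × F))
  | some m => LinearMap.ker
      (LinearMap.snd F (F × F) (F × F) - mulRight r s m ∘ₗ LinearMap.fst F (F × F) (F × F))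

theorem mem_component_none {v : (F × F) × (F × F)} : v ∈ component r s none ↔ v.1 = 0 := by
  simp [component]

theorem mem_component_some {v : (F × F) × (F × F)} {m : F × F} :
    v ∈ component r s (some m) ↔ v.2 = mul r s v.1 m := by
  simp [component, sub_eq_zero, mulRight_apply]

/-- By `mul_mul_self`, an eigenvalue of right multiplication by m would be a root of f. -/
theorem NoRoot.mul_ne_smul (hf : NoRoot r s) {m x : F × F} (hm : m.2 ≠ 0) (hx : x ≠ 0) (c : F) :
    mul r s x m ≠ c • x := by
  intro h
  have h2 := mul_mul_self (r := r) (s := s) x hm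
  have h3 : mul r s (c • x) m = c • mul r s x m := (mulRight r s m).map_smul c x
  rw [h, h3, h] at h2
  have h4 : (c ^ 2 - r * c - s) • x = 0 := by
    rw [sub_smul, sub_smul, pow_two, mul_smul, mul_smul, h2]; abel
  rcases smul_eq_zero.1 h4 with h5 | h5
  · exact hf c h5
  · exact hx h5

theorem NoRoot.cross_mul_ne_zero (hf : NoRoot r s) {m x : F × F} (hm : m.2 ≠ 0) (hx : x ≠ 0) :
    cross x (mul r s x m) ≠ 0 := fun h =>
  let ⟨c, hc⟩ := exists_smul_of_cross_eq_zero hx h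
  hf.mul_ne_smul hm hx c hc

/-- If m and n are both outside F, the quadratic relation makes their right multiplications agree at
xm as well as at x. These two vectors form a basis, so the maps also agree at 1. -/
theorem NoRoot.mul_left_cancel (hf : NoRoot r s) {m n x : F × F} (hx : x ≠ 0)
    (h : mul r s x m = mul r s x n) : m = n := by
  by_cases hm : m.2 = 0 <;> by_cases hn : n.2 = 0
  · rw [mul_of_snd_eq_zero _ hm, mul_of_snd_eq_zero _ hn] at h
    exact Prod.ext (smul_left_injective F hx h) (hm.trans hn.symm)
  · rw [mul_of_snd_eq_zero _ hm] at h
    exact absurd h.symm (hf.mul_ne_smul hn hx _)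
  · rw [mul_of_snd_eq_zero _ hn] at h
    exact absurd h (hf.mul_ne_smul hm hx _)
  · have h2 : mul r s (mul r s x m) m = mul r s (mul r s x m) n := by
      rw [mul_mul_self x hm, h, mul_mul_self x hn]
    have hc := eq_of_cross_ne_zero (hf.cross_mul_ne_zero hm hx) (1, 0)
    rw [← one_mul (r := r) (s := s) m, ← one_mul (r := r) (s := s) n, ← mulRight_apply,
      ← mulRight_apply, hc]
    simp only [map_add, map_smul, mulRight_apply]
    rw [← h2, h]

theorem NoRoot.eq_zero_of_mem (hf : NoRoot r s) {d e : Option (F × F)} (hde : d ≠ e)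
    {v : (F × F) × (F × F)} (hd : v ∈ component r s d) (he : v ∈ component r s e) : v = 0 := by
  have key : ∀ {m : F × F}, v ∈ component r s none → v ∈ component r s (some m) → v = 0 := by
    intro m h1 h2
    rw [mem_component_none] at h1
    rw [mem_component_some, h1, ← mulRight_apply, map_zero] at h2
    exact Prod.ext h1 h2
  rcases d with _ | m <;> rcases e with _ | n
  · exact absurd rfl hde
  · exact key hd he
  · exact key he hd
  · rw [mem_component_some] at hd he
    by_cases hx : v.1 = 0
    · exact key (mem_component_none.2 hx) (mem_component_some.2 hd)
    · exact absurd (congrArg some (hf.mul_left_cancel hx (hd.symm.trans he))) hde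

theorem mem_component_of_cross_eq_zero {x y : F × F} (hx : x ≠ 0) (h : cross x y = 0) :
    ∃ c : F, (x, y) ∈ component r s (some (c, 0)) := by
  obtain ⟨c, rfl⟩ := exists_smul_of_cross_eq_zero hx h
  exact ⟨c, mem_component_some.2 (mul_scalar x c).symm⟩

/-- Right multiplication by m must send x to y and y to ry + sx. Since (1, 0) = (y₂x - x₂y)/D with D
the determinant of x, y, its image m is forced. The second coordinate of m is P/D, where P is f made
homogeneous, evaluated at (y₂, x₂). -/
theorem NoRoot.exists_mul_eq (hf : NoRoot r s) {x y : F × F} (h : cross x y ≠ 0) :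
    ∃ m : F × F, m.2 ≠ 0 ∧ y = mul r s x m := by
  obtain ⟨x₁, x₂⟩ := x
  obtain ⟨y₁, y₂⟩ := y
  simp only [cross] at h
  have hq : y₂ ^ 2 - r * y₂ * x₂ - s * x₂ ^ 2 ≠ 0 := by
    apply hf.form_ne_zero
    rintro ⟨rfl, rfl⟩
    simp at h
  set D := x₁ * y₂ - x₂ * y₁ with hD
  set P := y₂ ^ 2 - r * y₂ * x₂ - s * x₂ ^ 2 with hP
  have hm : P / D ≠ 0 := div_ne_zero hq h
  refine ⟨((y₂ * y₁ - x₂ * (r * y₁ + s * x₁)) / D, P / D), hm, ?_⟩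
  rw [mul_of_snd_ne_zero _ hm]
  ext <;> simp only <;> field_simp <;> rw [hP, hD] <;> ring

theorem NoRoot.exists_mem (hf : NoRoot r s) (v : (F × F) × (F × F)) :
    ∃ d, v ∈ component r s d := by
  by_cases hx : v.1 = 0
  · exact ⟨none, mem_component_none.2 hx⟩
  by_cases h : cross v.1 v.2 = 0
  · obtain ⟨c, hc⟩ := mem_component_of_cross_eq_zero (r := r) (s := s) hx h
    exact ⟨_, hc⟩
  · obtain ⟨m, -, hm⟩ := hf.exists_mul_eq h
    exact ⟨some m, mem_component_some.2 hm⟩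

/-- Distinct components are complementary: the difference of two right multiplications is injective,
hence surjective by dimension. -/
theorem NoRoot.exists_add (hf : NoRoot r s) {d e : Option (F × F)} (hde : d ≠ e)
    (v : (F × F) × (F × F)) :
    ∃ u ∈ component r s d, ∃ w ∈ component r s e, v = u + w := by
  have key : ∀ m : F × F, ∃ u ∈ component r s none, ∃ w ∈ component r s (some m), v = u + w := by
    intro m
    refine ⟨(0, v.2 - mul r s v.1 m), mem_component_none.2 rfl, (v.1, mul r s v.1 m),
      mem_component_some.2 rfl, ?_⟩
    ext <;> simp
  rcases d with _ | m <;> rcases e with _ | n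
  · exact absurd rfl hde
  · exact key n
  · obtain ⟨u, hu, w, hw, h⟩ := key m
    exact ⟨w, hw, u, hu, h.trans (add_comm _ _)⟩
  · have hinj : Function.Injective (mulRight r s m - mulRight r s n) := by
      rw [← LinearMap.ker_eq_bot, LinearMap.ker_eq_bot']
      intro x hx
      by_contra hx0
      rw [LinearMap.sub_apply, sub_eq_zero] at hx
      exact hde (congrArg some (hf.mul_left_cancel hx0 hx))
    obtain ⟨x, hx⟩ := LinearMap.injective_iff_surjective.1 hinj (v.2 - mul r s v.1 n)
    rw [LinearMap.sub_apply, mulRight_apply, mulRight_apply] at hx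
    refine ⟨(x, mul r s x m), mem_component_some.2 rfl,
      (v.1 - x, mul r s (v.1 - x) n), mem_component_some.2 rfl, Prod.ext (by simp) ?_⟩
    have h2 : mul r s (v.1 - x) n = mul r s v.1 n - mul r s x n := (mulRight r s n).map_sub _ _
    rw [Prod.snd_add, h2]
    simp only
    rw [← add_sub_assoc, add_sub_right_comm, hx, sub_add_cancel]

variable (r s) in
/-- A linear parametrization of a component. -/
def param : Option (F × F) → (F × F →ₗ[F] (F × F) × (F × F))
  | none => LinearMap.inr F _ _
  | some m => LinearMap.prod LinearMap.id (mulRight r s m)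

theorem param_none (x : F × F) : param r s none x = (0, x) := rfl

theorem param_some (m x : F × F) : param r s (some m) x = (x, mul r s x m) := rfl

theorem param_mem (d : Option (F × F)) (x : F × F) : param r s d x ∈ component r s d := by
  rcases d with _ | m
  · simp [param, mem_component_none]
  · simp [param, mem_component_some, mulRight_apply]

theorem param_injective (d : Option (F × F)) : Function.Injective (param r s d) := by
  rcases d with _ | m
  · exact LinearMap.inr_injective
  · intro x y h
    exact congrArg Prod.fst h

theorem exists_param_eq {d : Option (F × F)} {v : (F × F) × (F × F)} (hv : v ∈ component r s d) :
    ∃ x, param r s d x = v := by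
  rcases d with _ | m
  · exact ⟨v.2, Prod.ext (mem_component_none.1 hv).symm rfl⟩
  · exact ⟨v.1, Prod.ext rfl (mem_component_some.1 hv).symm⟩

theorem exists_mem_ne (d : Option (F × F)) (v : (F × F) × (F × F)) :
    ∃ u ∈ component r s d, u ≠ 0 ∧ u ≠ v := by
  have hne : param r s d (1, 0) ≠ param r s d (0, 1) := fun h => by
    simpa using param_injective d h
  have h0 : ∀ x, x ≠ 0 → param r s d x ≠ 0 := fun x hx h =>
    hx (param_injective d (h.trans (map_zero _).symm))
  by_cases h : param r s d (1, 0) = v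
  · exact ⟨_, param_mem d (0, 1), h0 _ (by simp), fun h' => hne (h.trans h'.symm)⟩
  · exact ⟨_, param_mem d (1, 0), h0 _ (by simp), h⟩

theorem exists_ne_directions (d e g : Option (F × F)) :
    ∃ k : Option (F × F), k ≠ d ∧ k ≠ e ∧ k ≠ g := by
  have h : ({d, e, g} : Finset (Option (F × F))).card <
      ({none, some 0, some (1, 0), some (0, 1)} : Finset (Option (F × F))).card := by
    refine lt_of_le_of_lt Finset.card_le_three ?_
    rw [Finset.card_insert_of_notMem, Finset.card_insert_of_notMem, Finset.card_insert_of_notMem,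
      Finset.card_singleton] <;> simp [Prod.ext_iff]
  obtain ⟨k, -, hk⟩ := Finset.exists_mem_notMem_of_card_lt_card h
  simp only [Finset.mem_insert, Finset.mem_singleton, not_or] at hk
  exact ⟨k, hk⟩

/-! ### Lines and incidence -/

variable (r s) in
/-- The line of a given direction through the affine point with position vector `v`. -/
def line (d : Option (F × F)) (v : (F × F) × (F × F)) : Line F :=
  match d with
  | none => .vertical v.1
  | some m => .nonvertical m (v.2 - mul r s v.1 m)

theorem incident_pt_line {v w : (F × F) × (F × F)} {d : Option (F × F)} :
    Incident r s (pt v) (line r s d w) ↔ v - w ∈ component r s d := by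
  rcases d with _ | m
  · simp [pt, line, Incident, mem_component_none, sub_eq_zero]
  · have h : mul r s (v.1 - w.1) m = mul r s v.1 m - mul r s w.1 m := (mulRight r s m).map_sub _ _
    simp only [pt, line, Incident, mem_component_some, Prod.snd_sub, Prod.fst_sub, h]
    constructor <;> intro h'
    · rw [h']; abel
    · rw [← sub_eq_zero] at h' ⊢; rw [← h']; abel

theorem incident_inf_line {w : (F × F) × (F × F)} {d e : Option (F × F)} :
    Incident r s (inf e) (line r s d w) ↔ e = d := by
  rcases d with _ | m <;> rcases e with _ | n <;> simp [inf, line, Incident]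

theorem not_incident_pt_infinity {v : (F × F) × (F × F)} : ¬ Incident r s (pt v) .infinity := id

theorem incident_inf_infinity {d : Option (F × F)} : Incident r s (inf d) .infinity := by
  rcases d with _ | m <;> trivial

variable (r s) in
theorem line_cases (l : Line F) : (∃ d v, l = line r s d v) ∨ l = .infinity := by
  rcases l with ⟨m, k⟩ | c | _
  · exact .inl ⟨some m, (0, k), by
      have h : mul r s 0 m = 0 := (mulRight r s m).map_zero
      simp [line, h]⟩
  · exact .inl ⟨none, (c, 0), rfl⟩
  · exact .inr rfl

theorem line_eq_line {d : Option (F × F)} {v w : (F × F) × (F × F)}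
    (h : v - w ∈ component r s d) : line r s d v = line r s d w := by
  have h' := incident_pt_line.2 h
  rcases d with _ | m
  · simpa [pt, line, Incident] using h'
  · simp only [pt, line, Incident] at h' ⊢
    rw [h', add_sub_cancel_left]

/-- Two distinct points are on at most one common line. -/
theorem NoRoot.line_unique (hf : NoRoot r s) {P Q : Point F} (hPQ : P ≠ Q) {l m : Line F}
    (hPl : Incident r s P l) (hQl : Incident r s Q l) (hPm : Incident r s P m)
    (hQm : Incident r s Q m) : l = m := by
  have key : ∀ v e, Incident r s (pt v) l → Incident r s (inf e) l → l = line r s e v := by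
    intro v e h1 h2
    rcases line_cases r s l with ⟨d, w, rfl⟩ | rfl
    · obtain rfl := incident_inf_line.1 h2
      exact (line_eq_line (incident_pt_line.1 h1)).symm
    · exact absurd h1 not_incident_pt_infinity
  have key' : ∀ v e, Incident r s (pt v) m → Incident r s (inf e) m → m = line r s e v := by
    intro v e h1 h2
    rcases line_cases r s m with ⟨d, w, rfl⟩ | rfl
    · obtain rfl := incident_inf_line.1 h2
      exact (line_eq_line (incident_pt_line.1 h1)).symm
    · exact absurd h1 not_incident_pt_infinity
  rcases point_cases P with ⟨v, rfl⟩ | ⟨d, rfl⟩ <;> rcases point_cases Q with ⟨w, rfl⟩ | ⟨e, rfl⟩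
  · rcases line_cases r s l with ⟨d, x, rfl⟩ | rfl
    · rcases line_cases r s m with ⟨e, y, rfl⟩ | rfl
      · rw [incident_pt_line] at *
        have hd : v - w ∈ component r s d := by simpa using Submodule.sub_mem _ hPl hQl
        have he : v - w ∈ component r s e := by simpa using Submodule.sub_mem _ hPm hQm
        obtain rfl : d = e := by
          by_contra hde
          exact hPQ (congrArg pt (sub_eq_zero.1 (hf.eq_zero_of_mem hde hd he)))
        apply line_eq_line
        simpa using Submodule.sub_mem _ hPm hPl
      · exact absurd hPm not_incident_pt_infinity
    · exact absurd hPl not_incident_pt_infinity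
  · rw [key _ _ hPl hQl, key' _ _ hPm hQm]
  · rw [key _ _ hQl hPl, key' _ _ hQm hPm]
  · rcases line_cases r s l with ⟨k, x, rfl⟩ | rfl
    · rw [incident_inf_line] at hPl hQl
      exact absurd (congrArg inf (hPl.trans hQl.symm)) hPQ
    · rcases line_cases r s m with ⟨k, y, rfl⟩ | rfl
      · rw [incident_inf_line] at hPm hQm
        exact absurd (congrArg inf (hPm.trans hQm.symm)) hPQ
      · rfl

/-! ### Pappus configurations from their incidences -/

/-- The distinctness conditions in a Pappus configuration follow from those on the two given
triples. -/
theorem NoRoot.isPappus (hf : NoRoot r s) {A₁ B₁ C₁ A₂ B₂ C₂ A₃ B₃ C₃ : Point F}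
    {l₁ l₂ l₃ a a' b b' c c' : Line F}
    (h₁ : OnLine r s A₁ B₁ C₁ l₁) (h₂ : OnLine r s A₂ B₂ C₂ l₂)
    (hAB₁ : A₁ ≠ B₁) (hAC₁ : A₁ ≠ C₁) (hBC₁ : B₁ ≠ C₁)
    (hAB₂ : A₂ ≠ B₂) (hAC₂ : A₂ ≠ C₂) (hBC₂ : B₂ ≠ C₂)
    (hA₁ : ¬ Incident r s A₁ l₂) (hB₁ : ¬ Incident r s B₁ l₂) (hC₁ : ¬ Incident r s C₁ l₂)
    (hA₂ : ¬ Incident r s A₂ l₁) (hB₂ : ¬ Incident r s B₂ l₁) (hC₂ : ¬ Incident r s C₂ l₁)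
    (ha : OnLine r s B₁ C₂ A₃ a) (ha' : OnLine r s B₂ C₁ A₃ a')
    (hb : OnLine r s A₁ C₂ B₃ b) (hb' : OnLine r s A₂ C₁ B₃ b')
    (hc : OnLine r s A₁ B₂ C₃ c) (hc' : OnLine r s A₂ B₁ C₃ c')
    (h₃ : OnLine r s A₃ B₃ C₃ l₃) : IsPappus r s A₁ B₁ C₁ A₂ B₂ C₂ := by
  refine ⟨A₃, B₃, C₃, l₁, l₂, l₃, a, a', b, b', c, c', ?_, ?_, h₁, h₂, ha, ha', hb, hb', hc, hc',
    h₃⟩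
  all_goals
    obtain ⟨i1, i2, i3⟩ := h₁
    obtain ⟨j1, j2, j3⟩ := h₂
    obtain ⟨a1, a2, a3⟩ := ha
    obtain ⟨a1', a2', a3'⟩ := ha'
    obtain ⟨b1, b2, b3⟩ := hb
    obtain ⟨b1', b2', b3'⟩ := hb'
    obtain ⟨c1, c2, c3⟩ := hc
    obtain ⟨c1', c2', c3'⟩ := hc'
    obtain ⟨k1, k2, k3⟩ := h₃
    -- a line through a point off `l` meets `l` at most once
    have meet : ∀ {P Q R : Point F} {l m : Line F}, Incident r s P l → Incident r s Q l →
        Incident r s P m → Incident r s Q m → Incident r s R m → ¬ Incident r s R l → P = Q := by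
      intro P Q R l m h1 h2 h3 h4 h5 h6
      by_contra hPQ
      exact h6 (hf.line_unique hPQ h1 h2 h3 h4 ▸ h5)
    have off : ∀ {P Q R S T : Point F} {l m n : Line F}, Incident r s P l → Incident r s Q l →
        P ≠ Q → ¬ Incident r s R l → ¬ Incident r s S l → Incident r s P m → Incident r s R m →
        Incident r s Q n → Incident r s S n → Incident r s T m → Incident r s T n →
        ¬ Incident r s T l := by
      intro P Q R S T l m n h1 h2 h3 h4 h5 h6 h7 h8 h9 h10 h11 h12
      exact h3 ((meet h1 h12 h6 h10 h7 h4).trans (meet h2 h12 h8 h11 h9 h5).symm)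
    have oA₁ := off i2 i3 hBC₁ hC₂ hB₂ a1 a2 a2' a1' a3 a3'
    have oB₁ := off i1 i3 hAC₁ hC₂ hA₂ b1 b2 b2' b1' b3 b3'
    have oC₁ := off i1 i2 hAB₁ hB₂ hA₂ c1 c2 c2' c1' c3 c3'
    have oA₂ := off j3 j2 hBC₂.symm hB₁ hC₁ a2 a1 a1' a2' a3 a3'
    have oB₂ := off j3 j1 hAC₂.symm hA₁ hC₁ b2 b1 b1' b2' b3 b3'
    have oC₂ := off j2 j1 hAB₂.symm hA₁ hB₁ c2 c1 c1' c2' c3 c3'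
    have nab : a ≠ b := fun h => hAB₁ (meet i1 i2 b1 (h ▸ a1) b2 hC₂)
    have nac' : a ≠ c' := fun h => hAC₂ (meet j1 j3 c1' (h ▸ a2) c2' hB₁)
    have nbc : b ≠ c := fun h => hBC₂ (meet j2 j3 c2 (h ▸ b2) c1 hA₁)
    have nAB : A₃ ≠ B₃ := fun h => nab (hf.line_unique (P := A₃) (Q := C₂)
      (fun h' => oA₂ (h' ▸ j3)) a3 a2 (h ▸ b3) b2)
    have nAC : A₃ ≠ C₃ := fun h => nac' (hf.line_unique (P := A₃) (Q := B₁)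
      (fun h' => oA₁ (h' ▸ i2)) a3 a1 (h ▸ c3') c2')
    have nBC : B₃ ≠ C₃ := fun h => nbc (hf.line_unique (P := B₃) (Q := A₁)
      (fun h' => oB₁ (h' ▸ i1)) b3 b1 (h ▸ c3) c1)
  · have n₁ : ∀ {P Q : Point F}, Incident r s P l₁ → ¬ Incident r s Q l₁ → P ≠ Q :=
      fun h h' h'' => h' (h'' ▸ h)
    have n₂ : ∀ {P Q : Point F}, Incident r s P l₂ → ¬ Incident r s Q l₂ → P ≠ Q :=
      fun h h' h'' => h' (h'' ▸ h)
    simp only [List.nodup_cons, List.mem_cons, List.not_mem_nil, or_false, not_or,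
      not_false_eq_true, List.nodup_nil, and_true]
    exact ⟨⟨hAB₁, hAC₁, n₁ i1 hA₂, n₁ i1 hB₂, n₁ i1 hC₂, n₁ i1 oA₁, n₁ i1 oB₁, n₁ i1 oC₁⟩,
      ⟨hBC₁, n₁ i2 hA₂, n₁ i2 hB₂, n₁ i2 hC₂, n₁ i2 oA₁, n₁ i2 oB₁, n₁ i2 oC₁⟩,
      ⟨n₁ i3 hA₂, n₁ i3 hB₂, n₁ i3 hC₂, n₁ i3 oA₁, n₁ i3 oB₁, n₁ i3 oC₁⟩,
      ⟨hAB₂, hAC₂, n₂ j1 oA₂, n₂ j1 oB₂, n₂ j1 oC₂⟩,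
      ⟨hBC₂, n₂ j2 oA₂, n₂ j2 oB₂, n₂ j2 oC₂⟩, ⟨n₂ j3 oA₂, n₂ j3 oB₂, n₂ j3 oC₂⟩,
      ⟨nAB, nAC⟩, nBC⟩
  · -- two points on one of the first two lines, each on a cross line
    have m₁ : ∀ {P Q R : Point F} {m n : Line F}, P ≠ Q → Incident r s P l₁ → Incident r s Q l₁ →
        ¬ Incident r s R l₁ → Incident r s P m → Incident r s R m → Incident r s Q n → m ≠ n :=
      fun h1 h2 h3 h4 h5 h6 h7 h8 => h1 (meet h2 h3 h5 (h8 ▸ h7) h6 h4)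
    have m₂ : ∀ {P Q R : Point F} {m n : Line F}, P ≠ Q → Incident r s P l₂ → Incident r s Q l₂ →
        ¬ Incident r s R l₂ → Incident r s P m → Incident r s R m → Incident r s Q n → m ≠ n :=
      fun h1 h2 h3 h4 h5 h6 h7 h8 => h1 (meet h2 h3 h5 (h8 ▸ h7) h6 h4)
    have n₁ : ∀ {P : Point F} {m : Line F}, Incident r s P m → ¬ Incident r s P l₁ → l₁ ≠ m :=
      fun h h' h'' => h' (h'' ▸ h)
    have n₂ : ∀ {P : Point F} {m : Line F}, Incident r s P m → ¬ Incident r s P l₂ → l₂ ≠ m :=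
      fun h h' h'' => h' (h'' ▸ h)
    have lab' : a ≠ b' := m₁ hBC₁ i2 i3 hC₂ a1 a2 b2'
    have lac : a ≠ c := m₂ hBC₂.symm j3 j2 hB₁ a2 a1 c2
    have laa' : a ≠ a' := m₁ hBC₁ i2 i3 hC₂ a1 a2 a2'
    have la'b : a' ≠ b := m₂ hBC₂ j2 j3 hC₁ a1' a2' b2
    have la'b' : a' ≠ b' := m₂ hAB₂.symm j2 j1 hC₁ a1' a2' b1'
    have la'c : a' ≠ c := m₁ hAC₁.symm i3 i1 hB₂ a2' a1' c1
    have la'c' : a' ≠ c' := m₂ hAB₂.symm j2 j1 hC₁ a1' a2' c1'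
    have lbb' : b ≠ b' := m₁ hAC₁ i1 i3 hC₂ b1 b2 b2'
    have lbc' : b ≠ c' := m₁ hAB₁ i1 i2 hC₂ b1 b2 c2'
    have lb'c : b' ≠ c := m₁ hAC₁.symm i3 i1 hA₂ b2' b1' c1
    have lb'c' : b' ≠ c' := m₁ hBC₁.symm i3 i2 hA₂ b2' b1' c2'
    have lcc' : c ≠ c' := m₁ hAB₁ i1 i2 hB₂ c1 c2 c2'
    have pa : l₃ ≠ a := fun h => nab (hf.line_unique (P := B₃) (Q := C₂)
      (fun h' => oB₂ (h' ▸ j3)) (h ▸ k2) a2 b3 b2)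
    have pb : l₃ ≠ b := fun h => nab (hf.line_unique (P := A₃) (Q := C₂)
      (fun h' => oA₂ (h' ▸ j3)) a3 a2 (h ▸ k1) b2)
    have pa' : l₃ ≠ a' := fun h => la'b' (hf.line_unique (P := B₃) (Q := C₁)
      (fun h' => oB₁ (h' ▸ i3)) (h ▸ k2) a2' b3' b2')
    have pb' : l₃ ≠ b' := fun h => la'b' (hf.line_unique (P := A₃) (Q := C₁)
      (fun h' => oA₁ (h' ▸ i3)) a3' a2' (h ▸ k1) b2')
    have pc : l₃ ≠ c := fun h => la'c (hf.line_unique (P := A₃) (Q := B₂)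
      (fun h' => oA₂ (h' ▸ j2)) a3' a1' (h ▸ k1) c2)
    have pc' : l₃ ≠ c' := fun h => nac' (hf.line_unique (P := A₃) (Q := B₁)
      (fun h' => oA₁ (h' ▸ i2)) a3 a1 (h ▸ k1) c2')
    simp only [List.nodup_cons, List.mem_cons, List.not_mem_nil, or_false, not_or,
      not_false_eq_true, List.nodup_nil, and_true]
    exact ⟨⟨n₁ j1 hA₂, n₁ k1 oA₁, n₁ a2 hC₂, n₁ a1' hB₂, n₁ b2 hC₂, n₁ b1' hA₂, n₁ c2 hB₂,
        n₁ c1' hA₂⟩,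
      ⟨n₂ k1 oA₂, n₂ a1 hB₁, n₂ a2' hC₁, n₂ b1 hA₁, n₂ b2' hC₁, n₂ c1 hA₁, n₂ c2' hB₁⟩,
      ⟨pa, pa', pb, pb', pc, pc'⟩, ⟨laa', nab, lab', lac, nac'⟩, ⟨la'b, la'b', la'c, la'c'⟩,
      ⟨lbb', nbc, lbc'⟩, ⟨lb'c, lb'c'⟩, lcc'⟩

theorem IsPappus.swap {A₁ B₁ C₁ A₂ B₂ C₂ : Point F} (h : IsPappus r s A₁ B₁ C₁ A₂ B₂ C₂) :
    IsPappus r s B₁ A₁ C₁ B₂ A₂ C₂ := by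
  obtain ⟨A₃, B₃, C₃, g₁, g₂, g₃, a, a', b, b', c, c', hp, hl, h1, h2, h3, h4, h5, h6, h7, h8,
    h9⟩ := h
  refine ⟨B₃, A₃, C₃, g₁, g₂, g₃, b, b', a, a', c', c, ?_, ?_, ⟨h1.2.1, h1.1, h1.2.2⟩,
    ⟨h2.2.1, h2.1, h2.2.2⟩, h5, h6, h3, h4, ⟨h8.2.1, h8.1, h8.2.2⟩, ⟨h7.2.1, h7.1, h7.2.2⟩,
    ⟨h9.2.1, h9.1, h9.2.2⟩⟩
  · refine List.Perm.nodup ?_ hp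
    refine .trans (.swap _ _ _) (.cons _ (.cons _ (.cons _ (.trans (.swap _ _ _)
      (.cons _ (.cons _ (.cons _ (.swap _ _ _))))))))
  · refine List.Perm.nodup ?_ hl
    refine .cons _ (.cons _ (.cons _ ?_))
    exact (List.perm_append_comm (l₁ := [a, a']) (l₂ := [b, b'])).append (.swap c' c [])

theorem incident_pt_line_of_eq {d : Option (F × F)} {v w u : (F × F) × (F × F)}
    (hu : u ∈ component r s d) (h : v - w = u) : Incident r s (pt v) (line r s d w) :=
  incident_pt_line.2 (h ▸ hu)

theorem incident_pt_line_self {d : Option (F × F)} {v : (F × F) × (F × F)} :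
    Incident r s (pt v) (line r s d v) :=
  incident_pt_line_of_eq (Submodule.zero_mem _) (sub_self v)

theorem incident_inf_line_self {d : Option (F × F)} {v : (F × F) × (F × F)} :
    Incident r s (inf d) (line r s d v) :=
  incident_inf_line.2 rfl

/-! ### Positions settled by translations -/

/-- Subtracting b - a and u on the second line, where they are added on the first, makes opposite
sides have equal difference vectors. They are therefore parallel and the third line is at infinity.
-/
theorem NoRoot.exists_isPappus_of_parallel (hf : NoRoot r s) {d : Option (F × F)}
    {v₀ v₁ a b : (F × F) × (F × F)} (hv : v₁ - v₀ ∉ component r s d)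
    (ha : a - v₀ ∈ component r s d) (hb : b - v₀ ∈ component r s d) (hab : a ≠ b) :
    ∃ c a' b' c', Incident r s (pt c) (line r s d v₀) ∧ Incident r s (pt a') (line r s d v₁) ∧
      Incident r s (pt b') (line r s d v₁) ∧ Incident r s (pt c') (line r s d v₁) ∧
      IsPappus r s (pt a) (pt b) (pt c) (pt a') (pt b') (pt c') := by
  obtain ⟨u, hu, hu0, hub⟩ := exists_mem_ne (r := r) (s := s) d (b - a)
  have hba : b - a ∈ component r s d := by simpa using Submodule.sub_mem _ hb ha
  obtain ⟨e₁, he₁⟩ := hf.exists_mem (v₁ - b - u)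
  obtain ⟨e₂, he₂⟩ := hf.exists_mem (v₁ - a - u)
  obtain ⟨e₃, he₃⟩ := hf.exists_mem (v₁ - b)
  have hc : Incident r s (pt (a + u)) (line r s d v₀) :=
    incident_pt_line_of_eq (Submodule.add_mem _ ha hu) (by abel)
  have hb' : Incident r s (pt (v₁ - (b - a))) (line r s d v₁) :=
    incident_pt_line_of_eq (Submodule.neg_mem _ hba) (by abel)
  have hc' : Incident r s (pt (v₁ - u)) (line r s d v₁) :=
    incident_pt_line_of_eq (Submodule.neg_mem _ hu) (by abel)
  have off : ∀ {P : Point F}, P ≠ inf d → Incident r s P (line r s d v₀) →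
      ¬ Incident r s P (line r s d v₁) := by
    intro P hP h0 h1
    have h := hf.line_unique hP h0 incident_inf_line_self h1 incident_inf_line_self
    have h2 : Incident r s (pt v₁) (line r s d v₀) := h ▸ incident_pt_line_self
    exact hv (incident_pt_line.1 h2)
  have off' : ∀ {P : Point F}, P ≠ inf d → Incident r s P (line r s d v₁) →
      ¬ Incident r s P (line r s d v₀) := fun hP h h' => off hP h' h
  have ha0 := incident_pt_line.2 ha
  have hb0 := incident_pt_line.2 hb
  refine ⟨a + u, v₁, v₁ - (b - a), v₁ - u, hc, incident_pt_line_self, hb', hc',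
    hf.isPappus (A₃ := inf e₁) (B₃ := inf e₂) (C₃ := inf e₃) (l₃ := .infinity)
      (a := line r s e₁ b) (a' := line r s e₁ (a + u)) (b := line r s e₂ a)
      (b' := line r s e₂ (a + u)) (c := line r s e₃ a) (c' := line r s e₃ b)
    ⟨ha0, hb0, hc⟩ ⟨incident_pt_line_self, hb', hc'⟩
    (pt_injective.ne hab) (pt_injective.ne (by simpa using hu0))
    (pt_injective.ne fun h => hub (by rw [h]; abel))
    (pt_injective.ne fun h => hab (sub_eq_zero.1 (sub_eq_self.1 h.symm)).symm)
    (pt_injective.ne fun h => hu0 (sub_eq_self.1 h.symm))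
    (pt_injective.ne fun h => hub (by simpa using h.symm))
    (off (pt_ne_inf _ _) ha0) (off (pt_ne_inf _ _) hb0) (off (pt_ne_inf _ _) hc)
    (off' (pt_ne_inf _ _) incident_pt_line_self) (off' (pt_ne_inf _ _) hb')
    (off' (pt_ne_inf _ _) hc')
    ⟨incident_pt_line_self, incident_pt_line_of_eq he₁ (by abel), incident_inf_line_self⟩
    ⟨incident_pt_line_of_eq he₁ (by abel), incident_pt_line_self, incident_inf_line_self⟩
    ⟨incident_pt_line_self, incident_pt_line_of_eq he₂ (by abel), incident_inf_line_self⟩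
    ⟨incident_pt_line_of_eq he₂ (by abel), incident_pt_line_self, incident_inf_line_self⟩
    ⟨incident_pt_line_self, incident_pt_line_of_eq he₃ (by abel), incident_inf_line_self⟩
    ⟨incident_pt_line_of_eq he₃ (by abel), incident_pt_line_self, incident_inf_line_self⟩
    ⟨incident_inf_infinity, incident_inf_infinity, incident_inf_infinity⟩⟩

theorem exists_notMem (hf : NoRoot r s) (d e g : Option (F × F)) :
    ∃ w, w ∉ component r s d ∧ w ∉ component r s e ∧ w ∉ component r s g := by
  obtain ⟨k, hd, he, hg⟩ := exists_ne_directions d e g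
  obtain ⟨w, hw, hw0, -⟩ := exists_mem_ne (r := r) (s := s) k 0
  exact ⟨w, fun h => hw0 (hf.eq_zero_of_mem hd hw h), fun h => hw0 (hf.eq_zero_of_mem he hw h),
    fun h => hw0 (hf.eq_zero_of_mem hg hw h)⟩

/-- The chosen points at infinity are the directions of w - x for three distinct x in the component
d, with w off that component. So they are distinct from each other and from d. The third line is the
parallel to the first through a + w. -/
theorem NoRoot.exists_isPappus_of_right_eq_infinity (hf : NoRoot r s) {d : Option (F × F)}
    {v₀ a b : (F × F) × (F × F)} (ha : a - v₀ ∈ component r s d)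
    (hb : b - v₀ ∈ component r s d) (hab : a ≠ b) :
    ∃ c e₁ e₂ e₃, Incident r s (pt c) (line r s d v₀) ∧
      IsPappus r s (pt a) (pt b) (pt c) (inf e₁) (inf e₂) (inf e₃) := by
  obtain ⟨u, hu, hu0, hub⟩ := exists_mem_ne (r := r) (s := s) d (b - a)
  have hba : b - a ∈ component r s d := by simpa using Submodule.sub_mem _ hb ha
  obtain ⟨w, hw, -, -⟩ := exists_notMem hf d d d
  obtain ⟨e₁, he₁⟩ := hf.exists_mem (w - (b - a) - u)
  obtain ⟨e₂, he₂⟩ := hf.exists_mem (w - u)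
  obtain ⟨e₃, he₃⟩ := hf.exists_mem (w - (b - a))
  have hc : Incident r s (pt (a + u)) (line r s d v₀) :=
    incident_pt_line_of_eq (Submodule.add_mem _ ha hu) (by abel)
  have ne : ∀ {x : (F × F) × (F × F)} {e : Option (F × F)}, x ∈ component r s d →
      w - x ∈ component r s e → e ≠ d := by
    rintro x e hx h rfl
    exact hw (by simpa using Submodule.add_mem _ h hx)
  have ne' : ∀ {x y : (F × F) × (F × F)} {e g : Option (F × F)}, x ∈ component r s d →
      y ∈ component r s d → x ≠ y → w - x ∈ component r s e → w - y ∈ component r s g → e ≠ g := by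
    rintro x y e g hx hy hxy h h' rfl
    have h1 : y - x ∈ component r s e := by simpa using Submodule.sub_mem _ h h'
    exact hxy (sub_eq_zero.1 (hf.eq_zero_of_mem (ne hx h) h1 (Submodule.sub_mem _ hy hx))).symm
  have hbu := Submodule.add_mem _ hba hu
  rw [sub_sub] at he₁
  have hbu0 : b - a ≠ 0 := sub_ne_zero.2 hab.symm
  have ha0 := incident_pt_line.2 ha
  have hb0 := incident_pt_line.2 hb
  refine ⟨a + u, e₁, e₂, e₃, hc,
    hf.isPappus (A₃ := pt (a + w)) (B₃ := pt (a + a - b + w)) (C₃ := pt (a - u + w))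
      (l₂ := .infinity) (l₃ := line r s d (a + w))
      (a := line r s e₃ b) (a' := line r s e₂ (a + u)) (b := line r s e₃ a)
      (b' := line r s e₁ (a + u)) (c := line r s e₂ a) (c' := line r s e₁ b)
    ⟨ha0, hb0, hc⟩ ⟨incident_inf_infinity, incident_inf_infinity, incident_inf_infinity⟩
    (pt_injective.ne hab) (pt_injective.ne (by simpa using hu0))
    (pt_injective.ne fun h => hub (by rw [h]; abel))
    (inf_injective.ne (ne' hbu hu (by simpa using hbu0) he₁ he₂))
    (inf_injective.ne (ne' hbu hba (by simpa using hu0) he₁ he₃))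
    (inf_injective.ne (ne' hu hba hub he₂ he₃))
    not_incident_pt_infinity not_incident_pt_infinity not_incident_pt_infinity
    (fun h => ne hbu he₁ (incident_inf_line.1 h))
    (fun h => ne hu he₂ (incident_inf_line.1 h))
    (fun h => ne hba he₃ (incident_inf_line.1 h))
    ⟨incident_pt_line_self, incident_inf_line_self, incident_pt_line_of_eq he₃ (by abel)⟩
    ⟨incident_inf_line_self, incident_pt_line_self, incident_pt_line_of_eq he₂ (by abel)⟩
    ⟨incident_pt_line_self, incident_inf_line_self, incident_pt_line_of_eq he₃ (by abel)⟩
    ⟨incident_inf_line_self, incident_pt_line_self, incident_pt_line_of_eq he₁ (by abel)⟩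
    ⟨incident_pt_line_self, incident_inf_line_self, incident_pt_line_of_eq he₂ (by abel)⟩
    ⟨incident_inf_line_self, incident_pt_line_self, incident_pt_line_of_eq he₁ (by abel)⟩
    ⟨incident_pt_line_self, incident_pt_line_of_eq (Submodule.neg_mem _ hba) (by abel),
      incident_pt_line_of_eq (Submodule.neg_mem _ hu) (by abel)⟩⟩

/-- A vector w off d, e₁ and e₂ splits along d and e₁ and along d and e₂. Its d-parts y and x yield
the affine points v₁ + x, v₁ + y, v₁, and w - (x + y) yields the third point at infinity. -/
theorem NoRoot.exists_isPappus_of_left_eq_infinity (hf : NoRoot r s) {d e₁ e₂ : Option (F × F)}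
    (v₁ : (F × F) × (F × F)) (h₁₂ : e₁ ≠ e₂) (h₁ : e₁ ≠ d) (h₂ : e₂ ≠ d) :
    ∃ e₃ a b c, Incident r s (pt a) (line r s d v₁) ∧ Incident r s (pt b) (line r s d v₁) ∧
      Incident r s (pt c) (line r s d v₁) ∧
      IsPappus r s (inf e₁) (inf e₂) (inf e₃) (pt a) (pt b) (pt c) := by
  obtain ⟨w, hw, hw₁, hw₂⟩ := exists_notMem hf d e₁ e₂
  obtain ⟨y, hy, y', hy', hyw⟩ := hf.exists_add h₁.symm w
  obtain ⟨x, hx, x', hx', hxw⟩ := hf.exists_add h₂.symm w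
  have hwy : w - y ∈ component r s e₁ := by rw [hyw]; simpa using hy'
  have hwx : w - x ∈ component r s e₂ := by rw [hxw]; simpa using hx'
  obtain ⟨e₃, he₃⟩ := hf.exists_mem (w - (x + y))
  have hy0 : y ≠ 0 := by rintro rfl; exact hw₁ (by simpa using hwy)
  have hx0 : x ≠ 0 := by rintro rfl; exact hw₂ (by simpa using hwx)
  have ne : ∀ {x : (F × F) × (F × F)} {e : Option (F × F)}, x ∈ component r s d →
      w - x ∈ component r s e → e ≠ d := by
    rintro x e hx h rfl
    exact hw (by simpa using Submodule.add_mem _ h hx)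
  have ne' : ∀ {x y : (F × F) × (F × F)} {e g : Option (F × F)}, x ∈ component r s d →
      y ∈ component r s d → x ≠ y → w - x ∈ component r s e → w - y ∈ component r s g → e ≠ g := by
    rintro x y e g hx hy hxy h h' rfl
    have h1 : y - x ∈ component r s e := by simpa using Submodule.sub_mem _ h h'
    exact hxy (sub_eq_zero.1 (hf.eq_zero_of_mem (ne hx h) h1 (Submodule.sub_mem _ hy hx))).symm
  have hxy : x ≠ y := by
    rintro rfl
    have h := hf.eq_zero_of_mem h₁₂ hwy hwx
    exact hw (sub_eq_zero.1 h ▸ hx)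
  have hxy' := Submodule.add_mem _ hx hy
  have ha : Incident r s (pt (v₁ + x)) (line r s d v₁) := incident_pt_line_of_eq hx (by abel)
  have hb : Incident r s (pt (v₁ + y)) (line r s d v₁) := incident_pt_line_of_eq hy (by abel)
  refine ⟨e₃, v₁ + x, v₁ + y, v₁, ha, hb, incident_pt_line_self,
    hf.isPappus (A₃ := pt (v₁ + w - x)) (B₃ := pt (v₁ + w - y)) (C₃ := pt (v₁ + w))
      (l₁ := .infinity) (l₃ := line r s d (v₁ + w))
      (a := line r s e₂ v₁) (a' := line r s e₃ (v₁ + y)) (b := line r s e₁ v₁)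
      (b' := line r s e₃ (v₁ + x)) (c := line r s e₁ (v₁ + y)) (c' := line r s e₂ (v₁ + x))
    ⟨incident_inf_infinity, incident_inf_infinity, incident_inf_infinity⟩
    ⟨ha, hb, incident_pt_line_self⟩
    (inf_injective.ne h₁₂)
    (inf_injective.ne (ne' hy hxy' (by simpa using hx0) hwy he₃))
    (inf_injective.ne (ne' hx hxy' (by simpa using hy0) hwx he₃))
    (pt_injective.ne (by simpa using hxy)) (pt_injective.ne (by simpa using hx0))
    (pt_injective.ne (by simpa using hy0))
    (fun h => h₁ (incident_inf_line.1 h)) (fun h => h₂ (incident_inf_line.1 h))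
    (fun h => ne hxy' he₃ (incident_inf_line.1 h))
    not_incident_pt_infinity not_incident_pt_infinity not_incident_pt_infinity
    ⟨incident_inf_line_self, incident_pt_line_self, incident_pt_line_of_eq hwx (by abel)⟩
    ⟨incident_pt_line_self, incident_inf_line_self,
      incident_pt_line_of_eq he₃ (by abel)⟩
    ⟨incident_inf_line_self, incident_pt_line_self, incident_pt_line_of_eq hwy (by abel)⟩
    ⟨incident_pt_line_self, incident_inf_line_self,
      incident_pt_line_of_eq he₃ (by abel)⟩
    ⟨incident_inf_line_self, incident_pt_line_self, incident_pt_line_of_eq hwy (by abel)⟩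
    ⟨incident_pt_line_self, incident_inf_line_self, incident_pt_line_of_eq hwx (by abel)⟩
    ⟨incident_pt_line_of_eq (Submodule.neg_mem _ hx) (by abel),
      incident_pt_line_of_eq (Submodule.neg_mem _ hy) (by abel), incident_pt_line_self⟩⟩

theorem not_incident_add {d e : Option (F × F)} (hf : NoRoot r s) (hde : d ≠ e)
    {o x : (F × F) × (F × F)} (hx : x ∈ component r s d) (hx0 : x ≠ 0) :
    ¬ Incident r s (pt (o + x)) (line r s e o) := fun h =>
  hx0 (hf.eq_zero_of_mem hde hx (by simpa using incident_pt_line.1 h))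

theorem incident_add {d : Option (F × F)} {o x : (F × F) × (F × F)} (hx : x ∈ component r s d) :
    Incident r s (pt (o + x)) (line r s d o) :=
  incident_pt_line.2 (by simpa using hx)

/-- Projecting c and b to the second line along a third direction g gives b' and c'. The lines
through infinite points of the two given lines close up parallelograms at c + c' and b + b', whose
difference (b - c') - (c - b') again has direction g. -/
theorem NoRoot.exists_isPappus_of_left_point_at_infinity (hf : NoRoot r s)
    {d e : Option (F × F)} (hde : d ≠ e) (o : (F × F) × (F × F)) {b : (F × F) × (F × F)}
    (hb : b ∈ component r s d) (hb0 : b ≠ 0) :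
    ∃ c b' c', Incident r s (pt c) (line r s d o) ∧ Incident r s (pt b') (line r s e o) ∧
      Incident r s (pt c') (line r s e o) ∧
      IsPappus r s (inf d) (pt (o + b)) (pt c) (inf e) (pt b') (pt c') := by
  obtain ⟨c, hc, hc0, hcb⟩ := exists_mem_ne (r := r) (s := s) d b
  obtain ⟨g, hgd, hge, -⟩ := exists_ne_directions d e e
  obtain ⟨x, hx, b', hb', hcx⟩ := hf.exists_add hge c
  obtain ⟨y, hy, c', hc', hby⟩ := hf.exists_add hge b
  have hx0 : b' ≠ 0 := by
    rintro rfl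
    exact hc0 (hf.eq_zero_of_mem hgd (by rwa [hcx, add_zero]) hc)
  have hy0 : c' ≠ 0 := by
    rintro rfl
    exact hb0 (hf.eq_zero_of_mem hgd (by rwa [hby, add_zero]) hb)
  have hne : b' ≠ c' := by
    rintro rfl
    have h : c - b ∈ component r s g := by
      rw [hcx, hby]
      simpa using Submodule.sub_mem _ hx hy
    exact hcb (sub_eq_zero.1 (hf.eq_zero_of_mem hgd h (Submodule.sub_mem _ hc hb)))
  refine ⟨o + c, o + b', o + c', incident_add hc, incident_add hb', incident_add hc',
    hf.isPappus (A₃ := inf g) (B₃ := pt (o + c + c')) (C₃ := pt (o + b + b'))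
      (l₃ := line r s g (o + c + c'))
      (a := line r s g (o + b)) (a' := line r s g (o + c)) (b := line r s d (o + c'))
      (b' := line r s e (o + c)) (c := line r s d (o + b')) (c' := line r s e (o + b))
    ⟨incident_inf_line_self, incident_add hb, incident_add hc⟩
    ⟨incident_inf_line_self, incident_add hb', incident_add hc'⟩
    (pt_ne_inf _ _).symm (pt_ne_inf _ _).symm (pt_injective.ne (by simpa using hcb.symm))
    (pt_ne_inf _ _).symm (pt_ne_inf _ _).symm (pt_injective.ne (by simpa using hne))
    (fun h => hde (incident_inf_line.1 h)) (not_incident_add hf hde hb hb0)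
    (not_incident_add hf hde hc hc0)
    (fun h => hde.symm (incident_inf_line.1 h)) (not_incident_add hf hde.symm hb' hx0)
    (not_incident_add hf hde.symm hc' hy0)
    ⟨incident_pt_line_self,
      incident_pt_line_of_eq (Submodule.neg_mem _ hy) (by rw [hby]; abel),
      incident_inf_line_self⟩
    ⟨incident_pt_line_of_eq (Submodule.neg_mem _ hx) (by rw [hcx]; abel), incident_pt_line_self,
      incident_inf_line_self⟩
    ⟨incident_inf_line_self, incident_pt_line_self, incident_pt_line_of_eq hc (by abel)⟩
    ⟨incident_inf_line_self, incident_pt_line_self, incident_pt_line_of_eq hc' (by abel)⟩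
    ⟨incident_inf_line_self, incident_pt_line_self, incident_pt_line_of_eq hb (by abel)⟩
    ⟨incident_inf_line_self, incident_pt_line_self, incident_pt_line_of_eq hb' (by abel)⟩
    ⟨incident_inf_line_self, incident_pt_line_self,
      incident_pt_line_of_eq (Submodule.sub_mem _ hy hx) (by rw [hby, hcx]; abel)⟩⟩

/-! ### Reduction to hexagons with parallel opposite sides -/

variable (r s) in
/-- Two vectors are in a common component of the spread. -/
def Par (v w : (F × F) × (F × F)) : Prop := ∃ d, v ∈ component r s d ∧ w ∈ component r s d

/-- `HasHexagon` is phrased by `Par`, without named directions, so that collineations carry it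
along; a nonzero vector recovers its direction here. -/
theorem NoRoot.mem_of_par (hf : NoRoot r s) {v w : (F × F) × (F × F)} {d : Option (F × F)}
    (hv : v ∈ component r s d) (hv0 : v ≠ 0) (h : Par r s v w) : w ∈ component r s d := by
  obtain ⟨e, he, hw⟩ := h
  by_cases hde : d = e
  · exact hde ▸ hw
  · exact absurd (hf.eq_zero_of_mem hde hv he) hv0

variable (r s) in
/-- The vectors `a`, `b` and vectors `c` of the component of `a` and `a'`, `b'`, `c'` of the
component of `w` form a hexagon whose three pairs of opposite sides are parallel. -/
def HasHexagon (a b w : (F × F) × (F × F)) : Prop :=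
  ∃ c a' b' c', (Par r s a c ∧ c ≠ 0 ∧ a ≠ c ∧ b ≠ c) ∧ (Par r s w a' ∧ Par r s w b' ∧ Par r s w
    c') ∧
    (a' ≠ 0 ∧ b' ≠ 0 ∧ c' ≠ 0) ∧ (a' ≠ b' ∧ a' ≠ c' ∧ b' ≠ c') ∧
    Par r s (b - c') (c - b') ∧ Par r s (a - c') (c - a') ∧ Par r s (a - b') (b - a')

theorem NoRoot.exists_isPappus_of_hasHexagon (hf : NoRoot r s)
    {d e : Option (F × F)} (hde : d ≠ e) (o : (F × F) × (F × F)) {a b w : (F × F) × (F × F)}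
    (ha : a ∈ component r s d) (ha0 : a ≠ 0) (hb : b ∈ component r s d) (hb0 : b ≠ 0) (hab : a ≠ b)
    (hw : w ∈ component r s e) (hw0 : w ≠ 0) (h : HasHexagon r s a b w) :
    ∃ c a' b' c', Incident r s (pt c) (line r s d o) ∧ Incident r s (pt a') (line r s e o) ∧
      Incident r s (pt b') (line r s e o) ∧ Incident r s (pt c') (line r s e o) ∧
      IsPappus r s (pt (o + a)) (pt (o + b)) (pt c) (pt a') (pt b') (pt c') := by
  obtain ⟨c, a', b', c', ⟨hc, hc0, hac, hbc⟩, ⟨ha', hb', hc'⟩, ⟨ha0', hb0', hc0'⟩,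
    ⟨hab', hac', hbc'⟩, ⟨e₁, h1, h1'⟩, ⟨e₂, h2, h2'⟩, ⟨e₃, h3, h3'⟩⟩ := h
  replace hc := hf.mem_of_par ha ha0 hc
  replace ha' := hf.mem_of_par hw hw0 ha'
  replace hb' := hf.mem_of_par hw hw0 hb'
  replace hc' := hf.mem_of_par hw hw0 hc'
  exact ⟨o + c, o + a', o + b', o + c', incident_add hc, incident_add ha', incident_add hb',
    incident_add hc',
    hf.isPappus (A₃ := inf e₁) (B₃ := inf e₂) (C₃ := inf e₃) (l₃ := .infinity)
      (a := line r s e₁ (o + c')) (a' := line r s e₁ (o + b')) (b := line r s e₂ (o + c'))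
      (b' := line r s e₂ (o + a')) (c := line r s e₃ (o + b')) (c' := line r s e₃ (o + a'))
    ⟨incident_add ha, incident_add hb, incident_add hc⟩
    ⟨incident_add ha', incident_add hb', incident_add hc'⟩
    (pt_injective.ne (by simpa using hab)) (pt_injective.ne (by simpa using hac))
    (pt_injective.ne (by simpa using hbc))
    (pt_injective.ne (by simpa using hab')) (pt_injective.ne (by simpa using hac'))
    (pt_injective.ne (by simpa using hbc'))
    (not_incident_add hf hde ha ha0) (not_incident_add hf hde hb hb0)
    (not_incident_add hf hde hc hc0)
    (not_incident_add hf hde.symm ha' ha0') (not_incident_add hf hde.symm hb' hb0')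
    (not_incident_add hf hde.symm hc' hc0')
    ⟨incident_pt_line_of_eq h1 (by abel), incident_pt_line_self, incident_inf_line_self⟩
    ⟨incident_pt_line_self, incident_pt_line_of_eq h1' (by abel), incident_inf_line_self⟩
    ⟨incident_pt_line_of_eq h2 (by abel), incident_pt_line_self, incident_inf_line_self⟩
    ⟨incident_pt_line_self, incident_pt_line_of_eq h2' (by abel), incident_inf_line_self⟩
    ⟨incident_pt_line_of_eq h3 (by abel), incident_pt_line_self, incident_inf_line_self⟩
    ⟨incident_pt_line_self, incident_pt_line_of_eq h3' (by abel), incident_inf_line_self⟩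
    ⟨incident_inf_infinity, incident_inf_infinity, incident_inf_infinity⟩⟩

theorem NoRoot.par_smul_right (hf : NoRoot r s) (v : (F × F) × (F × F)) (c : F) :
    Par r s v (c • v) :=
  let ⟨d, hd⟩ := hf.exists_mem v
  ⟨d, hd, Submodule.smul_mem _ c hd⟩

/-! ### Two sources of hexagons -/

/-- Hexagons from two components that are proportional as maps between two further components. -/
theorem NoRoot.hasHexagon_of_proportional (hf : NoRoot r s) {p q : F × F →ₗ[F] (F × F) × (F × F)}
    {d e g k : Option (F × F)} (hp : Function.Injective p) (hq : Function.Injective q)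
    (hd : ∀ x, p x ∈ component r s d) (he : ∀ x, q x ∈ component r s e)
    (hg : ∀ x, p x + q x ∈ component r s g) {t : F} (ht0 : t ≠ 0) (ht1 : t ≠ 1)
    (hk : ∀ x, p x + t • q x ∈ component r s k) {x y : F × F} (hx : x ≠ 0) (hy : y ≠ 0)
    (hxy : x ≠ y) {w : (F × F) × (F × F)} (hw : w ∈ component r s e) :
    HasHexagon r s (p x) (p y) w := by
  have hp0 : ∀ {z}, z ≠ 0 → p z ≠ 0 := fun hz h => hz (hp (h.trans (map_zero p).symm))
  have hq0 : ∀ {z}, z ≠ 0 → -q z ≠ 0 := fun hz h =>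
    hz (hq ((neg_eq_zero.1 h).trans (map_zero q).symm))
  have hqn : ∀ {z z'}, z ≠ z' → -q z ≠ -q z' := fun hz h => hz (hq (neg_injective h))
  have par : ∀ z, Par r s w (-q z) := fun z => ⟨e, hw, Submodule.neg_mem _ (he z)⟩
  have ht1' : ∀ {z : F × F}, z ≠ 0 → t • z ≠ z := fun hz h =>
    ht1 (smul_left_injective F hz (h.trans (one_smul F _).symm))
  -- The general choice c = p(tx) makes two pairs of sides fall into g and k, and the third pair
  -- consist of px + qy and its multiple by t. If y = tx, this c equals b; then c = pz with z
  -- independent of x is used, and the third pair becomes px + qz and its multiple by t.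
  by_cases h : y = t • x
  · obtain ⟨z, hz⟩ := exists_cross_ne_zero hx
    have hzx : ∀ c : F, z ≠ c • x := by
      rintro c rfl
      simp [cross] at hz
      exact hz (by ring)
    have hz0 : z ≠ 0 := by simpa using hzx 0
    have hzx1 : z ≠ x := by simpa using hzx 1
    refine ⟨p z, -q (t • z), -q z, -q y, ⟨⟨d, hd _, hd _⟩, hp0 hz0, hp.ne hzx1.symm,
      hp.ne (h ▸ (hzx t).symm)⟩, ⟨par _, par _, par _⟩, ⟨hq0 (smul_ne_zero ht0 hz0), hq0 hz0, hq0
      hy⟩,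
      ⟨hqn (ht1' hz0), hqn ?_, hqn (h ▸ hzx t)⟩, ⟨g, ?_, ?_⟩, ⟨k, ?_, ?_⟩, ?_⟩
    · rw [h]
      exact fun h' => hzx1 (smul_right_injective _ ht0 h')
    · simpa using hg y
    · simpa using hg z
    · simpa [h] using hk x
    · simpa using hk z
    · simpa [h] using hf.par_smul_right (p x + q z) t
  · have htx := smul_ne_zero ht0 hx
    refine ⟨p (t • x), -q (t • y), -q (t • x), -q y, ⟨⟨d, hd _, hd _⟩, hp0 htx,
      hp.ne (ht1' hx).symm, hp.ne h⟩, ⟨par _, par _, par _⟩, ⟨hq0 (smul_ne_zero ht0 hy), hq0 htx,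
      hq0 hy⟩,
      ⟨hqn ?_, hqn (ht1' hy), hqn (Ne.symm h)⟩, ⟨g, ?_, ?_⟩, ?_, ⟨k, ?_, ?_⟩⟩
    · exact fun h' => hxy (smul_right_injective _ ht0 h').symm
    · simpa using hg y
    · simpa using hg (t • x)
    · simpa using hf.par_smul_right (p x + q y) t
    · simpa using hk x
    · simpa using hk y

/-- Hexagons from two commuting maps that fix all components. -/
theorem NoRoot.hasHexagon_of_commute (hf : NoRoot r s)
    {f g : (F × F) × (F × F) →ₗ[F] (F × F) × (F × F)}
    (hfd : ∀ d, ∀ v ∈ component r s d, f v ∈ component r s d)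
    (hgd : ∀ d, ∀ v ∈ component r s d, g v ∈ component r s d) (hfg : ∀ v, f (g v) = g (f v))
    (hf0 : ∀ v, f v = 0 → v = 0) (hf1 : ∀ v, f v = v → v = 0)
    (hg0 : ∀ v, g v = 0 → v = 0) (hg1 : ∀ v, g v = v → v = 0)
    (hne : ∀ v, f v = g v → v = 0) {a w : (F × F) × (F × F)} (ha : a ≠ 0) (hw : w ≠ 0) :
    HasHexagon r s a (f a) w := by
  have par : ∀ v, Par r s (f v) (g v) := fun v =>
    let ⟨d, hd⟩ := hf.exists_mem v
    ⟨d, hfd d v hd, hgd d v hd⟩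
  have parf : ∀ v, Par r s v (f v) := fun v =>
    let ⟨d, hd⟩ := hf.exists_mem v
    ⟨d, hd, hfd d v hd⟩
  have parg : ∀ v, Par r s v (g v) := fun v =>
    let ⟨d, hd⟩ := hf.exists_mem v
    ⟨d, hd, hgd d v hd⟩
  have parfg : Par r s w (f (g w)) :=
    let ⟨d, hd⟩ := hf.exists_mem w
    ⟨d, hd, hfd d _ (hgd d w hd)⟩
  have hgw : g w ≠ 0 := fun h => hw (hg0 _ h)
  have hfw : f w ≠ 0 := fun h => hw (hf0 _ h)
  -- The pairs of opposite sides are f and g applied to a - w, then a - fw and its image under g,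
  -- then a - gw and its image under f.
  refine ⟨g a, f (g w), g w, f w, ⟨parg a, fun h => ha (hg0 _ h), fun h => ha (hg1 _ h.symm),
    fun h => ha (hne _ h)⟩, ⟨parfg, parg w, parf w⟩, ⟨fun h => hgw (hf0 _ h), hgw, hfw⟩,
    ⟨fun h => hgw (hf1 _ h), fun h => hfw (hg1 _ ((hfg w).symm.trans h)),
      fun h => hw (hne _ h.symm)⟩, ?_, ?_, ?_⟩
  · simpa using par (a - w)
  · rw [hfg, ← map_sub]
    exact parg _
  · rw [← map_sub]
    exact parf _

/-! ### The collineations J + c -/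

theorem HasHexagon.map {f : (F × F) × (F × F) →ₗ[F] (F × F) × (F × F)}
    (hf : Function.Injective f) (hpar : ∀ v w, Par r s v w → Par r s (f v) (f w))
    {a b w : (F × F) × (F × F)} (h : HasHexagon r s a b w) : HasHexagon r s (f a) (f b) (f w) := by
  obtain ⟨c, a', b', c', ⟨hc, hc0, hac, hbc⟩, ⟨ha', hb', hc'⟩, ⟨ha0', hb0', hc0'⟩,
    ⟨hab', hac', hbc'⟩, h1, h2, h3⟩ := h
  have h0 : ∀ {v}, v ≠ 0 → f v ≠ 0 := fun hv h => hv (hf (h.trans (map_zero f).symm))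
  refine ⟨f c, f a', f b', f c', ⟨hpar _ _ hc, h0 hc0, hf.ne hac, hf.ne hbc⟩,
    ⟨hpar _ _ ha', hpar _ _ hb', hpar _ _ hc'⟩, ⟨h0 ha0', h0 hb0', h0 hc0'⟩,
    ⟨hf.ne hab', hf.ne hac', hf.ne hbc'⟩, ?_, ?_, ?_⟩
  · simpa using hpar _ _ h1
  · simpa using hpar _ _ h2
  · simpa using hpar _ _ h3

/-- On first coordinates J acts here as x ↦ rx - xm, multiplication by the conjugate of m, which
commutes with multiplication by m. -/
theorem shift_mem {m : F × F} (hm : m.2 ≠ 0) {c : F} {v : (F × F) × (F × F)}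
    (hv : v ∈ component r s (some m)) : shift r s c v ∈ component r s (some m) := by
  rw [mem_component_some] at hv ⊢
  rw [shift_apply, hv]
  simp only
  rw [← mulRight_apply m ((r + c) • v.1 - _), map_sub, map_smul]
  simp only [mulRight_apply]
  rw [mul_mul_self _ hm, add_smul]
  abel

theorem mem_component_scalar {c : F} {v : (F × F) × (F × F)} :
    v ∈ component r s (some (c, 0)) ↔ v.2 = c • v.1 := by
  rw [mem_component_some, mul_scalar]

/-- J + c fixes every component of slope outside F. The vertical component goes to slope -c and the
slopes in F are moved by the fractional linear map m ↦ (cm - s)/(r + c - m), a zero denominator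
giving the vertical component. -/
theorem par_shift (c : F) {v w : (F × F) × (F × F)} (h : Par r s v w) :
    Par r s (shift r s c v) (shift r s c w) := by
  obtain ⟨d, hv, hw⟩ := h
  suffices ∃ d', ∀ v ∈ component r s d, shift r s c v ∈ component r s d' from
    let ⟨d', hd'⟩ := this
    ⟨d', hd' v hv, hd' w hw⟩
  rcases d with _ | m
  · refine ⟨some (-c, 0), fun v hv => ?_⟩
    rw [mem_component_none] at hv
    rw [mem_component_scalar]
    simp [shift_apply, hv]
  by_cases hm : m.2 = 0
  · by_cases h0 : r + c - m.1 = 0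
    · refine ⟨none, fun v hv => ?_⟩
      rw [mem_component_some, mul_of_snd_eq_zero _ hm] at hv
      rw [mem_component_none, shift_apply, hv]
      simp only
      rw [← sub_smul, h0, zero_smul]
    · refine ⟨some ((c * m.1 - s) / (r + c - m.1), 0), fun v hv => ?_⟩
      rw [mem_component_some, mul_of_snd_eq_zero _ hm] at hv
      rw [mem_component_scalar, shift_apply, hv]
      simp only
      rw [← sub_smul, smul_smul, smul_smul, ← sub_smul, div_mul_cancel₀ _ h0]
  · exact ⟨some m, fun v hv => shift_mem hm hv⟩

theorem NoRoot.hasHexagon_of_shift (hf : NoRoot r s) (c : F) {a b w : (F × F) × (F × F)}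
    (h : HasHexagon r s (shift r s c a) (shift r s c b) (shift r s c w)) :
    HasHexagon r s a b w := by
  set t := -((-c) ^ 2 - r * (-c) - s) with ht
  have ht0 : t ≠ 0 := neg_ne_zero.2 (hf (-c))
  have key : ∀ v, (t⁻¹ • shift r s (-(r + c))) (shift r s c v) = v := fun v => by
    rw [LinearMap.smul_apply, shift_shift, ← ht, inv_smul_smul₀ ht0]
  have h' := h.map (f := t⁻¹ • shift r s (-(r + c)))
    (fun v w hvw => hf.shift_injective _ (smul_right_injective _ (inv_ne_zero ht0) hvw))
    (fun v w hvw => by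
      obtain ⟨d, hv, hw⟩ := par_shift (-(r + c)) hvw
      exact ⟨d, Submodule.smul_mem _ _ hv, Submodule.smul_mem _ _ hw⟩)
  rwa [key, key, key] at h'

/-! ### The field with two elements -/

/-- Having no root forces r = s = 1, so H is the field of order 4 and multiplication by its
generator (0, 1) preserves every component. Call this map f. The nonzero vectors of the component of
a are a, fa and f²a, so b is one of the last two, and f commutes with f². -/
theorem NoRoot.hasHexagon_of_forall_eq_zero_or_one (hf : NoRoot r s)
    (h01 : ∀ x : F, x = 0 ∨ x = 1) {d : Option (F × F)} {a b w : (F × F) × (F × F)}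
    (ha : a ∈ component r s d) (ha0 : a ≠ 0) (hb : b ∈ component r s d) (hb0 : b ≠ 0)
    (hab : a ≠ b) (hw0 : w ≠ 0) : HasHexagon r s a b w := by
  have two : (1 + 1 : F) = 0 := (h01 _).resolve_right (by simp)
  have neg : (-1 : F) = 1 := neg_eq_of_add_eq_zero_left two
  obtain rfl : s = 1 := (h01 s).resolve_left fun h => hf 0 (by simp [h])
  obtain rfl : r = 1 := (h01 r).resolve_left fun h => hf 1 (by simp [h])
  set T := mulRight (1 : F) 1 (0, 1) with hT
  have T_apply : ∀ x, T x = (x.2, x.1 + x.2) := fun x => by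
    simp [hT, mulRight_apply, mul]
  set f : (F × F) × (F × F) →ₗ[F] (F × F) × (F × F) := T.prodMap T with hfdef
  have f_param : ∀ d x, f (param 1 1 d x) = param 1 1 d (T x) := by
    intro d x
    rcases d with _ | ⟨m₁, m₂⟩
    · simp [hfdef, param]
    · obtain ⟨x₁, x₂⟩ := x
      rcases h01 m₁ with rfl | rfl <;> rcases h01 m₂ with rfl | rfl <;>
      rcases h01 x₁ with rfl | rfl <;> rcases h01 x₂ with rfl | rfl <;>
        simp [hfdef, param, T_apply, mulRight_apply, mul, two, neg]
  have hfd : ∀ d, ∀ v ∈ component 1 1 d, f v ∈ component 1 1 d := by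
    intro d v hv
    obtain ⟨x, rfl⟩ := exists_param_eq hv
    rw [f_param]
    exact param_mem _ _
  have sq : ∀ v, f (f v) = f v + v := by
    intro v
    ext <;> simp [hfdef, T_apply]
    all_goals ring
  have dbl : ∀ v : (F × F) × (F × F), v + v = 0 := fun v => by
    rw [← two_smul F, ← one_add_one_eq_two, two, zero_smul]
  have hf0 : ∀ v, f v = 0 → v = 0 := fun v hv => by simpa [hv] using (sq v).symm
  have hf1 : ∀ v, f v = v → v = 0 := fun v hv => by simpa [hv, dbl] using sq v
  have hg1 : ∀ v, (f ∘ₗ f) v = v → v = 0 := fun v hv => by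
    rw [LinearMap.comp_apply, sq] at hv
    exact hf0 v (by simpa using hv)
  have hg0 : ∀ v, (f ∘ₗ f) v = 0 → v = 0 := fun v hv => hf0 v (hf0 _ hv)
  have hgd : ∀ d, ∀ v ∈ component 1 1 d, (f ∘ₗ f) v ∈ component 1 1 d :=
    fun d v hv => hfd d _ (hfd d v hv)
  have hne : ∀ v, f v = (f ∘ₗ f) v → v = 0 := fun v hv => hf0 v (hf1 _ hv.symm)
  have hb' : b = f a ∨ b = (f ∘ₗ f) a := by
    obtain ⟨⟨x₁, x₂⟩, rfl⟩ := exists_param_eq ha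
    obtain ⟨⟨y₁, y₂⟩, rfl⟩ := exists_param_eq hb
    rw [LinearMap.comp_apply, f_param, f_param, (param_injective d).eq_iff,
      (param_injective d).eq_iff]
    rw [T_apply, T_apply]
    exact eq_or_eq_of_forall_eq_zero_or_one h01 (fun h => ha0 (by rw [h, map_zero]))
      (fun h => hb0 (by rw [h, map_zero])) (fun h => hab (by rw [h]))
  rcases hb' with rfl | rfl
  · exact hf.hasHexagon_of_commute hfd hgd (fun _ => rfl) hf0 hf1 hg0 hg1 hne ha0 hw0
  · exact hf.hasHexagon_of_commute hgd hfd (fun _ => rfl) hg0 hg1 hf0 hf1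
      (fun v hv => hne v hv.symm) ha0 hw0

/-! ### Hexagons with a vertical component -/

variable (r s) in
/-- The linear map `x ↦ c x - x m`. -/
def pencil (m : F × F) (c : F) : F × F →ₗ[F] F × F := c • LinearMap.id - mulRight r s m

theorem pencil_apply (m : F × F) (c : F) (x : F × F) :
    pencil r s m c x = c • x - mul r s x m := rfl

theorem pencil_comm (m : F × F) (c c' : F) (x : F × F) :
    pencil r s m c (pencil r s m c' x) = pencil r s m c' (pencil r s m c x) := by
  simp only [pencil, LinearMap.sub_apply, LinearMap.smul_apply, LinearMap.id_apply, map_sub,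
    map_smul, smul_sub, smul_comm c c']
  abel

theorem NoRoot.pencil_injective (hf : NoRoot r s) {m : F × F} (hm : m.2 ≠ 0) (c : F) :
    Function.Injective (pencil r s m c) := by
  rw [← LinearMap.ker_eq_bot, LinearMap.ker_eq_bot']
  intro x hx
  by_contra hx0
  rw [pencil_apply, sub_eq_zero] at hx
  exact hf.mul_ne_smul hm hx0 c hx.symm

theorem pencil_ne {m : F × F} {c c' : F} (h : c ≠ c') {x : F × F} (hx : x ≠ 0) :
    pencil r s m c x ≠ pencil r s m c' x := by
  rw [pencil_apply, pencil_apply]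
  exact fun h' => h (smul_left_injective F hx (sub_left_injective h'))

/-- Two linearly independent vectors are the values at a common vector of two members of the
pencil. -/
theorem NoRoot.exists_pencil_eq (hf : NoRoot r s) {m : F × F} (hm : m.2 ≠ 0) {x y : F × F}
    (hxy : cross x y ≠ 0) :
    ∃ z c c', z ≠ 0 ∧ c ≠ c' ∧ pencil r s m c z = x ∧ pencil r s m c' z = y := by
  have hd : cross (x - y) x ≠ 0 := by
    intro h
    apply hxy
    unfold cross at h ⊢
    simp at h
    linear_combination h
  have hd0 : x - y ≠ 0 := by
    intro h
    rw [h] at hd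
    simp [cross] at hd
  -- The difference of two members of the pencil at z is a multiple of z, so z has to be
  -- proportional to x - y. Expanding (x - y)m in the basis x - y, x gives the scale of z and the
  -- two scalars.
  have he := eq_of_cross_ne_zero hd (mul r s (x - y) m)
  set c := cross (mul r s (x - y) m) x / cross (x - y) x
  set t := cross (x - y) (mul r s (x - y) m) / cross (x - y) x
  have ht : t ≠ 0 := by
    intro ht
    rw [ht, zero_smul, add_zero] at he
    exact hf.mul_ne_smul hm hd0 _ he
  have key : ∀ a : F, pencil r s m a (-t⁻¹ • (x - y)) = (-t⁻¹ * (a - c)) • (x - y) + x := by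
    intro a
    rw [map_smul, pencil_apply, he, ← sub_sub, ← sub_smul, smul_sub, smul_smul, neg_smul t⁻¹ (t •
        x),
      inv_smul_smul₀ ht, sub_neg_eq_add]
  refine ⟨-t⁻¹ • (x - y), c, c + t, smul_ne_zero (neg_ne_zero.2 (inv_ne_zero ht)) hd0,
    by simpa using ht, ?_, ?_⟩
  · rw [key]; simp
  · rw [key, add_sub_cancel_left, neg_mul, inv_mul_cancel₀ ht]; simp

/-- The conjugate of an element outside the basefield. -/
theorem mul_conj (x : F × F) {m : F × F} (hm : m.2 ≠ 0) :
    mul r s x (r - m.1, -m.2) = r • x - mul r s x m := by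
  rw [mul_of_snd_ne_zero _ hm, mul_of_snd_ne_zero _ (neg_ne_zero.2 hm)]
  ext
  · simp; field_simp; ring
  · simp; ring

/-- The scalars t and t + 1 act as commuting maps. In characteristic 2 they are distinct and neither
is 0 or 1. -/
theorem NoRoot.hasHexagon_of_eq_smul (hf : NoRoot r s) (h2 : (2 : F) = 0) {t : F} (ht0 : t ≠ 0)
    (ht1 : t ≠ 1) {a w : (F × F) × (F × F)} (ha : a ≠ 0) (hw : w ≠ 0) :
    HasHexagon r s a (t • a) w := by
  have smul_eq : ∀ {c : F} {v : (F × F) × (F × F)}, c ≠ 0 → c • v = 0 → v = 0 :=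
    fun hc h => (smul_eq_zero.1 h).resolve_left hc
  have ht : t + 1 ≠ 0 := fun h => ht1 (by linear_combination h - h2)
  refine hf.hasHexagon_of_commute (f := t • LinearMap.id) (g := (t + 1) • LinearMap.id)
    (fun d v hv => Submodule.smul_mem _ _ hv) (fun d v hv => Submodule.smul_mem _ _ hv)
    (fun v => ?_) (fun v hv => ?_) (fun v hv => ?_) (fun v hv => ?_) (fun v hv => ?_)
    (fun v hv => ?_) ha hw
  · simp [smul_comm t (t + 1)]
  · exact smul_eq ht0 hv
  · refine smul_eq (sub_ne_zero.2 ht1) ?_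
    rw [sub_smul, one_smul, sub_eq_zero]
    exact hv
  · exact smul_eq ht hv
  · refine smul_eq ht0 ?_
    simpa [add_smul] using hv
  · simpa [add_smul] using hv

theorem NoRoot.hasHexagon_of_left_vertical (hf : NoRoot r s) {t : F} (ht0 : t ≠ 0) (ht1 : t ≠ 1)
    {x y m : F × F} (hx : x ≠ 0) (hy : y ≠ 0) (hxy : x ≠ y) {w : (F × F) × (F × F)}
    (hw : w ∈ component r s (some m)) (hw0 : w ≠ 0) : HasHexagon r s (0, x) (0, y) w := by
  by_cases hm : m.2 = 0
  · refine hf.hasHexagon_of_proportional (p := param r s none) (q := param r s (some m))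
      (g := some (1 + m.1, 0)) (k := some (t⁻¹ + m.1, 0)) (param_injective _) (param_injective _)
      (param_mem _) (param_mem _) (fun z => ?_) ht0 ht1 (fun z => ?_) hx hy hxy hw
    · rw [mem_component_scalar]
      simp [param, mulRight_apply, mul_of_snd_eq_zero _ hm, add_smul]
    · rw [mem_component_scalar]
      simp [param, mulRight_apply, mul_of_snd_eq_zero _ hm, smul_smul, mul_comm _ t,
        mul_add, add_smul, ht0]
  by_cases h2 : (2 : F) = 0
  · by_cases hc : cross x y = 0
    · obtain ⟨c, rfl⟩ := exists_smul_of_cross_eq_zero hx hc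
      have h : ((0, c • x) : (F × F) × (F × F)) = c • (0, x) := by ext <;> simp
      rw [h]
      refine hf.hasHexagon_of_eq_smul h2 ?_ ?_ (fun h => hx (congrArg Prod.snd h)) hw0
      · rintro rfl
        simp at hy
      · rintro rfl
        simp at hxy
    · obtain ⟨u, c₂, c₁, hu0, hc₁₂, hux, huy⟩ := hf.exists_pencil_eq hm hc
      obtain ⟨c₃, hc₃₂, hc₃₁⟩ := exists_ne_of_ne_zero_of_ne_one ht0 ht1 c₂ c₁
      obtain ⟨z, rfl⟩ := LinearMap.injective_iff_surjective.1 (hf.pencil_injective hm c₃) u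
      have hz0 : z ≠ 0 := by
        rintro rfl
        simp at hu0
      set g := pencil r s m with hg
      have hg0 : ∀ c {v}, v ≠ 0 → g c v ≠ 0 := fun c v hv h =>
        hv (hf.pencil_injective hm c (h.trans (map_zero _).symm))
      set e := param r s (some m) with he
      have hen : ∀ {v v'}, v ≠ v' → -e v ≠ -e v' := fun hv h =>
        hv (param_injective _ (neg_injective h))
      have he0 : ∀ {v}, v ≠ 0 → -e v ≠ 0 := fun hv h =>
        hv (param_injective _ ((neg_eq_zero.1 h).trans (map_zero _).symm))
      have par : ∀ v, Par r s w (-e v) := fun v => ⟨_, hw, Submodule.neg_mem _ (param_mem _ _)⟩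
      have mem : ∀ c v v', v' = g c v → (0, v') - -e v ∈ component r s (some (c, 0)) := by
        rintro c v _ rfl
        rw [mem_component_scalar]
        simp [hg, he, param, pencil_apply, mulRight_apply]
      have comm : ∀ c c' v, g c (g c' v) = g c' (g c v) := pencil_comm m
      have ne : ∀ {v v' : F × F}, v ≠ v' → ((0, v) : (F × F) × (F × F)) ≠ (0, v') :=
        fun h h' => h (congrArg Prod.snd h')
      -- Each vertical point is a product of two of the three maps `g cᵢ` at z, and each opposite
      -- point is a single map at z. The side that adds the factor `g cᵢ` has slope cᵢ, and as the
      -- maps commute, each slope serves two opposite sides.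
      refine ⟨(0, g c₁ (g c₂ z)), -e (g c₁ z), -e (g c₂ z), -e (g c₃ z),
        ⟨⟨none, mem_component_none.2 rfl, mem_component_none.2 rfl⟩,
          ne (v' := 0) (hg0 _ (hg0 _ hz0)), ne ?_, ne ?_⟩, ⟨par _, par _, par _⟩,
        ⟨he0 (hg0 _ hz0), he0 (hg0 _ hz0), he0 (hg0 _ hz0)⟩,
        ⟨hen (pencil_ne hc₁₂.symm hz0), hen (pencil_ne hc₃₁.symm hz0),
          hen (pencil_ne hc₃₂.symm hz0)⟩,
        ⟨_, mem c₁ _ _ huy.symm, mem c₁ _ _ rfl⟩,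
        ⟨_, mem c₂ _ _ hux.symm, mem c₂ _ _ (comm _ _ _)⟩,
        ⟨_, mem c₃ _ _ (by rw [← hux]; exact comm _ _ _),
          mem c₃ _ _ (by rw [← huy]; exact comm _ _ _)⟩⟩
      · rw [← hux, comm c₁]
        exact (hf.pencil_injective hm c₂).ne (pencil_ne hc₃₁ hz0)
      · rw [← huy]
        exact (hf.pencil_injective hm c₁).ne (pencil_ne hc₃₂ hz0)
  · have hinj : Function.Injective ((2 : F) • pencil r s m (r / 2)) := fun v v' h =>
      hf.pencil_injective hm _ (smul_right_injective _ h2 h)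
    have key : ∀ z, ((2 : F) • pencil r s m (r / 2)) z = r • z - (2 : F) • mul r s z m := by
      intro z
      rw [LinearMap.smul_apply, pencil_apply, smul_sub, smul_smul, mul_div_cancel₀ _ h2]
    have hsurj := LinearMap.injective_iff_surjective.1 hinj
    obtain ⟨x, rfl⟩ := hsurj x
    obtain ⟨y, rfl⟩ := hsurj y
    -- With pz = (0, rz - 2zm) and qz = (z, zm), the sum p + q has the conjugate of m as slope, and
    -- p + 2q has slope r/2 in F. Hence t = 2.
    refine hf.hasHexagon_of_proportional (d := none)
      (p := param r s none ∘ₗ ((2 : F) • pencil r s m (r / 2)))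
      (q := param r s (some m)) (g := some (r - m.1, -m.2)) (k := some (r / 2, 0)) (t := 2)
      ((param_injective (r := r) (s := s) none).comp hinj) (param_injective _) (fun z =>
      param_mem none _)
      (param_mem _) (fun z => ?_) h2 ?_ (fun z => ?_) ?_ ?_ ?_ hw
    · rw [mem_component_some]
      simp only [LinearMap.comp_apply, key, param_none, param_some, Prod.mk_add_mk, zero_add,
        mul_conj _ hm]
      rw [two_smul]
      abel
    · intro h
      exact one_ne_zero (α := F) (by linear_combination h)
    · rw [mem_component_scalar]
      simp only [LinearMap.comp_apply, key, param_none, param_some, Prod.smul_mk, Prod.mk_add_mk,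
        zero_add,
        smul_smul, div_mul_cancel₀ _ h2, sub_add_cancel]
    · rintro rfl
      simp at hx
    · rintro rfl
      simp at hy
    · rintro rfl
      simp at hxy

/-- This is the previous situation with the components interchanged: in characteristic 2 the single
maps of the pencil sit on the first component and the products on the vertical one; otherwise p and
q trade places and t becomes 1/2. -/
theorem NoRoot.hasHexagon_of_right_vertical (hf : NoRoot r s) {t : F} (ht0 : t ≠ 0) (ht1 : t ≠ 1)
    {m : F × F} (hm : m.2 ≠ 0) {x y : F × F} (hx : x ≠ 0) (hy : y ≠ 0) (hxy : x ≠ y)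
    {w : (F × F) × (F × F)} (hw : w ∈ component r s none) (hw0 : w ≠ 0) :
    HasHexagon r s (param r s (some m) x) (param r s (some m) y) w := by
  have he0 : ∀ {v}, v ≠ 0 → param r s (some m) v ≠ 0 := fun hv h =>
    hv (param_injective _ (h.trans (map_zero _).symm))
  by_cases h2 : (2 : F) = 0
  · by_cases hc : cross x y = 0
    · obtain ⟨c, rfl⟩ := exists_smul_of_cross_eq_zero hx hc
      rw [map_smul]
      refine hf.hasHexagon_of_eq_smul h2 ?_ ?_ (he0 hx) hw0
      · rintro rfl
        simp at hy
      · rintro rfl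
        simp at hxy
    · obtain ⟨z, c₁, c₂, hz0, hc₁₂, rfl, rfl⟩ := hf.exists_pencil_eq hm hc
      obtain ⟨c₃, hc₃₁, hc₃₂⟩ := exists_ne_of_ne_zero_of_ne_one ht0 ht1 c₁ c₂
      set g := pencil r s m with hg
      have hg0 : ∀ c {v}, v ≠ 0 → g c v ≠ 0 := fun c v hv h =>
        hv (hf.pencil_injective hm c (h.trans (map_zero _).symm))
      set e := param r s (some m) with he
      have par : ∀ v, Par r s w (0, -v) := fun v => ⟨_, hw, mem_component_none.2 rfl⟩
      have mem : ∀ c v v', v' = g c v → e v - (0, -v') ∈ component r s (some (c, 0)) := by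
        rintro c v _ rfl
        rw [mem_component_scalar]
        simp [hg, he, param, pencil_apply, mulRight_apply]
      have comm : ∀ c c' v, g c (g c' v) = g c' (g c v) := pencil_comm m
      have ne : ∀ {v v' : F × F}, v ≠ v' → ((0, -v) : (F × F) × (F × F)) ≠ (0, -v') :=
        fun h h' => h (neg_injective (congrArg Prod.snd h'))
      have ne0 : ∀ {v : F × F}, v ≠ 0 → ((0, -v) : (F × F) × (F × F)) ≠ 0 :=
        fun h h' => h (neg_eq_zero.1 (congrArg Prod.snd h'))
      have en : ∀ {v v'}, v ≠ v' → e v ≠ e v' := fun h => (param_injective _).ne h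
      have gn : ∀ c {v v'}, v ≠ v' → g c v ≠ g c v' := fun c {v v'} h =>
        (hf.pencil_injective hm c).ne h
      refine ⟨e (g c₃ z), (0, -g c₂ (g c₃ z)), (0, -g c₁ (g c₃ z)), (0, -g c₁ (g c₂ z)),
        ⟨⟨_, param_mem _ _, param_mem _ _⟩, he0 (hg0 _ hz0), en (pencil_ne hc₃₁.symm hz0),
          en (pencil_ne hc₃₂.symm hz0)⟩, ⟨par _, par _, par _⟩,
        ⟨ne0 (hg0 _ (hg0 _ hz0)), ne0 (hg0 _ (hg0 _ hz0)), ne0 (hg0 _ (hg0 _ hz0))⟩,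
        ⟨ne (pencil_ne hc₁₂.symm (hg0 _ hz0)), ne ?_, ne (gn _ (pencil_ne hc₃₂ hz0))⟩,
        ⟨_, mem c₁ _ _ rfl, mem c₁ _ _ rfl⟩,
        ⟨_, mem c₂ _ _ (comm _ _ _), mem c₂ _ _ rfl⟩,
        ⟨_, mem c₃ _ _ (comm _ _ _), mem c₃ _ _ (comm _ _ _)⟩⟩
      rw [comm c₁]
      exact gn _ (pencil_ne hc₃₁ hz0)
  · have h2' : (2 : F)⁻¹ ≠ 0 := inv_ne_zero h2
    have hinj : Function.Injective ((2 : F) • pencil r s m (r / 2)) := fun v v' h =>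
      hf.pencil_injective hm _ (smul_right_injective _ h2 h)
    have key : ∀ z, ((2 : F) • pencil r s m (r / 2)) z = r • z - (2 : F) • mul r s z m := by
      intro z
      rw [LinearMap.smul_apply, pencil_apply, smul_sub, smul_smul, mul_div_cancel₀ _ h2]
    refine hf.hasHexagon_of_proportional (e := none) (p := param r s (some m))
      (q := param r s none ∘ₗ ((2 : F) • pencil r s m (r / 2)))
      (g := some (r - m.1, -m.2)) (k := some (r / 2, 0)) (t := 2⁻¹)
      (param_injective _) ((param_injective (r := r) (s := s) none).comp hinj) (param_mem _)
      (fun z => param_mem none _) (fun z => ?_) h2' ?_ (fun z => ?_) hx hy hxy hw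
    · rw [mem_component_some]
      simp only [LinearMap.comp_apply, key, param_none, param_some, Prod.mk_add_mk, add_zero,
        mul_conj _ hm]
      rw [two_smul]
      abel
    · intro h
      rw [inv_eq_one] at h
      exact one_ne_zero (α := F) (by linear_combination h)
    · rw [mem_component_scalar]
      simp only [LinearMap.comp_apply, key, param_none, param_some, Prod.smul_mk, Prod.mk_add_mk,
        smul_zero,
        add_zero, smul_sub, smul_smul, inv_mul_cancel₀ h2, one_smul, add_sub_cancel]
      rw [div_eq_inv_mul]

/-! ### Two components of slope outside F -/

theorem NoRoot.form_ne_zero_of_mem (hf : NoRoot r s) {m : F × F} (hm : m.2 ≠ 0)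
    {v : (F × F) × (F × F)} (hv : v ∈ component r s (some m)) (hv0 : v ≠ 0) : form v ≠ 0 := by
  obtain ⟨x, rfl⟩ := exists_param_eq hv
  have hx : x ≠ 0 := by
    rintro rfl
    exact hv0 (map_zero _)
  exact hf.cross_mul_ne_zero hm hx

theorem span_mem {m : F × F} (hm : m.2 ≠ 0) {v : (F × F) × (F × F)}
    (hv : v ∈ component r s (some m)) (x : F × F) : span r s v x ∈ component r s (some m) :=
  Submodule.add_mem _ (Submodule.smul_mem _ _ hv) (Submodule.smul_mem _ _ (shift_mem hm hv))

theorem NoRoot.exists_span_eq (hf : NoRoot r s) {m : F × F} (hm : m.2 ≠ 0)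
    {v w : (F × F) × (F × F)} (hv : v ∈ component r s (some m)) (hv0 : v ≠ 0)
    (hw : w ∈ component r s (some m)) : ∃ x, span r s v x = w := by
  have fst_inj : ∀ {u u' : (F × F) × (F × F)}, u ∈ component r s (some m) →
      u' ∈ component r s (some m) → u.1 = u'.1 → u = u' := by
    intro u u' hu hu' h
    rw [mem_component_some] at hu hu'
    exact Prod.ext h (by rw [hu, hu', h])
  have hinj : Function.Injective (LinearMap.fst F (F × F) (F × F) ∘ₗ span r s v) :=
    fun x y h => hf.span_injective hv0 (fst_inj (span_mem hm hv x) (span_mem hm hv y) h)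
  obtain ⟨x, hx⟩ := LinearMap.injective_iff_surjective.1 hinj w.1
  exact ⟨x, fst_inj (span_mem hm hv x) hw hx⟩

theorem NoRoot.exists_form_add_ne_zero (hf : NoRoot r s) {t : F} (ht0 : t ≠ 0) (ht1 : t ≠ 1)
    {m : F × F} (hm : m.2 ≠ 0) {a w : (F × F) × (F × F)} (ha : form a ≠ 0)
    (hw : w ∈ component r s (some m)) (hw0 : w ≠ 0) :
    ∃ u ∈ component r s (some m), u ≠ 0 ∧ ∃ c : F, c ≠ 0 ∧ c ≠ 1 ∧ form (a + u) ≠ 0 ∧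
      form (a + c • u) ≠ 0 := by
  have hform : ∀ {v}, v ∈ component r s (some m) → v ≠ 0 → form v ≠ 0 :=
    hf.form_ne_zero_of_mem hm
  -- The linear form `polar a` has a nonzero zero in the plane spanned by w and Jw. Along it, `form`
  -- has no linear term in c.
  obtain ⟨v, hv, hv0, hav⟩ : ∃ v ∈ component r s (some m), v ≠ 0 ∧ polar a v = 0 := by
    by_cases h : polar a w = 0
    · exact ⟨w, hw, hw0, h⟩
    · refine ⟨shift r s 0 w - (polar a (shift r s 0 w) / polar a w) • w,
        Submodule.sub_mem _ (shift_mem hm hw) (Submodule.smul_mem _ _ hw),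
        hf.shift_sub_smul_ne_zero hw0 _, ?_⟩
      have h' : ∀ (u : (F × F) × (F × F)) (c : F), polar a (u - c • w) = polar a u - c * polar a
          w := by
        intro u c
        simp [polar, cross]
        ring
      rw [h', div_mul_cancel₀ _ h, sub_self]
  have hav' : ∀ c : F, form (a + c • v) = form a + c ^ 2 * form v := by
    intro c
    rw [form_add_smul, hav, mul_zero, add_zero]
  by_cases h2 : (2 : F) = 0
  -- Squaring is injective in characteristic 2, so at most one of the scalars 1, t, t + 1 is bad;
  -- two of the others are taken as u and its multiple.
  · have uniq : ∀ c c' : F, form (a + c • v) = 0 → form (a + c' • v) = 0 → c = c' := by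
      intro c c' hc hc'
      rw [hav'] at hc hc'
      have h : (c - c') ^ 2 * form v = 0 := by
        linear_combination hc - hc' + (c' ^ 2 - c * c') * form v * h2
      simpa [hform hv hv0, sub_eq_zero] using h
    have ht : t + 1 ≠ 0 := fun h => ht1 (by linear_combination h - h2)
    by_cases h1 : form (a + (1 : F) • v) = 0
    · refine ⟨t • v, Submodule.smul_mem _ _ hv, smul_ne_zero ht0 hv0, (t + 1) / t,
        div_ne_zero ht ht0, ?_, fun h => ht1 (uniq _ _ h h1), ?_⟩
      · rw [ne_eq, div_eq_one_iff_eq ht0]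
        simp
      · rw [smul_smul, div_mul_cancel₀ _ ht0]
        exact fun h => ht0 (by simpa using uniq _ _ h h1)
    · by_cases h3 : form (a + t • v) = 0
      · refine ⟨v, hv, hv0, t + 1, ht, by simpa using ht0, by simpa using h1, fun h => ?_⟩
        simpa using uniq _ _ h h3
      · exact ⟨v, hv, hv0, t, ht0, ht1, by simpa using h1, h3⟩
  · by_contra! hcon
    -- Failure for the scalar -1 means that `form` vanishes at a + u or a - u. Applied to v and 2v
    -- this forces characteristic 3.
    have sq : ∀ u ∈ component r s (some m), u ≠ 0 → (form a + form u) ^ 2 = polar a u ^ 2 := by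
      intro u hu hu0
      have h1 := form_add_smul a u 1
      have h1' := form_add_smul a u (-1)
      rw [one_smul] at h1
      by_cases h : form (a + u) = 0
      · rw [h] at h1
        linear_combination (-(form a + form u - polar a u)) * h1
      · have h3 := hcon u hu hu0 (-1) (by simp) (fun h' => h2 (by linear_combination -h')) h
        rw [h3] at h1'
        linear_combination (-(form a + form u + polar a u)) * h1'
    have e1 : form a + form v = 0 := by simpa [hav] using sq v hv hv0
    have h3 : (3 : F) * form a = 0 := by
      have h := sq ((2 : F) • v) (Submodule.smul_mem _ _ hv) (smul_ne_zero h2 hv0)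
      have h4 : form ((2 : F) • v) = 4 * form v := by simp [form, cross]; ring
      have h5 : polar a ((2 : F) • v) = 2 * polar a v := by simp [polar, cross]; ring
      rw [h4, h5, hav, mul_zero, zero_pow two_ne_zero] at h
      linear_combination 4 * e1 - (pow_eq_zero_iff two_ne_zero).1 h
    replace h3 : (3 : F) = 0 := (mul_eq_zero.1 h3).resolve_right ha
    -- At Jv + cv with c = 0, 1, -1 the value of `polar a` is the same. Comparing the three squares
    -- gives, up to factors that are nonzero values of `form`, that the polar value of Jv and v is
    -- both form a and -form a.
    set u := shift r s 0 v with hu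
    have hum : u ∈ component r s (some m) := shift_mem hm hv
    have hadd : ∀ c : F, u + c • v ∈ component r s (some m) :=
      fun c => Submodule.add_mem _ hum (Submodule.smul_mem _ _ hv)
    have hadd0 : ∀ c : F, u + c • v ≠ 0 := fun c => by
      simpa using hf.shift_sub_smul_ne_zero hv0 (-c)
    have hpol : ∀ c : F, polar a (u + c • v) = polar a u := fun c => by
      have h : polar a (u + c • v) = polar a u + c * polar a v := by simp [polar, cross]; ring
      rw [h, hav, mul_zero, add_zero]
    have s0 := sq _ (hadd 0) (hadd0 0)
    have s1 := sq _ (hadd 1) (hadd0 1)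
    have s2 := sq _ (hadd (-1)) (hadd0 (-1))
    have n1 := hform (hadd 1) (hadd0 1)
    have n2 := hform (hadd (-1)) (hadd0 (-1))
    rw [hpol, form_add_smul] at s0 s1 s2
    rw [form_add_smul] at n1 n2
    generalize form u = x at *
    generalize polar u v = y at *
    generalize polar a u = z at *
    have y1 : y - form a = 0 := by
      refine (mul_eq_zero.1 ?_).resolve_right n2
      linear_combination s0 - s1 + (y - form a) * x * h3 + (form v + 3 * y + 2 * x) * e1
    have y2 : y + form a = 0 := by
      refine (mul_eq_zero.1 ?_).resolve_right n1
      linear_combination s2 - s0 + (y * (form a + x + form v) - x * form v) * h3 +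
        (x - form v) * e1
    exact mul_ne_zero h2 ha (by linear_combination y2 - y1)

/-- The parametrizations `span` are additive in their vector, so p + q and p + cq are spans of a + u
and a + cu. They stay in one component because `form` is nonzero there, which puts these vectors in
components invariant under J. -/
theorem NoRoot.hasHexagon_of_nonscalar (hf : NoRoot r s) {t : F} (ht0 : t ≠ 0) (ht1 : t ≠ 1)
    {m n : F × F} (hm : m.2 ≠ 0) (hn : n.2 ≠ 0) {a b w : (F × F) × (F × F)}
    (ha : a ∈ component r s (some m)) (ha0 : a ≠ 0) (hb : b ∈ component r s (some m))
    (hb0 : b ≠ 0) (hab : a ≠ b) (hw : w ∈ component r s (some n)) (hw0 : w ≠ 0) :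
    HasHexagon r s a b w := by
  obtain ⟨u, hu, hu0, c, hc0, hc1, h1, h2⟩ :=
    hf.exists_form_add_ne_zero ht0 ht1 hn (hf.form_ne_zero_of_mem hm ha ha0) hw hw0
  obtain ⟨g, hg, hg'⟩ := hf.exists_mul_eq h1
  obtain ⟨k, hk, hk'⟩ := hf.exists_mul_eq h2
  obtain ⟨x, hx⟩ := hf.exists_span_eq hm ha ha0 ha
  obtain ⟨y, hy⟩ := hf.exists_span_eq hm ha ha0 hb
  rw [← hy]
  nth_rw 1 [← hx]
  refine hf.hasHexagon_of_proportional (hf.span_injective ha0) (hf.span_injective hu0)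
    (span_mem hm ha) (span_mem hn hu) (g := some g) (k := some k) (fun z => ?_) hc0 hc1
    (fun z => ?_) ?_ ?_ ?_ hw
  · rw [span_add]
    exact span_mem hg (mem_component_some.2 hg') z
  · rw [span_smul, span_add]
    exact span_mem hk (mem_component_some.2 hk') z
  · rintro rfl
    exact ha0 (by rw [← hx, map_zero])
  · rintro rfl
    exact hb0 (by rw [← hy, map_zero])
  · rintro rfl
    exact hab (hx.symm.trans hy)

/-! ### Assembling the cases -/

theorem NoRoot.hasHexagon (hf : NoRoot r s) {d e : Option (F × F)} (hde : d ≠ e)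
    {a b w : (F × F) × (F × F)} (ha : a ∈ component r s d) (ha0 : a ≠ 0)
    (hb : b ∈ component r s d) (hb0 : b ≠ 0) (hab : a ≠ b) (hw : w ∈ component r s e)
    (hw0 : w ≠ 0) : HasHexagon r s a b w := by
  by_cases h01 : ∀ x : F, x = 0 ∨ x = 1
  · exact hf.hasHexagon_of_forall_eq_zero_or_one h01 ha ha0 hb hb0 hab hw0
  push Not at h01
  obtain ⟨t, ht0, ht1⟩ := h01
  have vert : ∀ {a b w : (F × F) × (F × F)}, a ∈ component r s none → a ≠ 0 →
      b ∈ component r s none → b ≠ 0 → a ≠ b → w ∉ component r s none → HasHexagon r s a b w := by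
    intro a b w ha ha0 hb hb0 hab hw
    obtain ⟨x, rfl⟩ := exists_param_eq ha
    obtain ⟨y, rfl⟩ := exists_param_eq hb
    obtain ⟨e, he⟩ := hf.exists_mem w
    rcases e with _ | m
    · exact absurd he hw
    · refine hf.hasHexagon_of_left_vertical ht0 ht1 ?_ ?_ ?_ he ?_
      · rintro rfl
        exact ha0 (map_zero _)
      · rintro rfl
        exact hb0 (map_zero _)
      · rintro rfl
        exact hab rfl
      · rintro rfl
        exact hw (Submodule.zero_mem _)
  -- For c = m.1 - r the first coordinate of (J + c)(x, y) is m.1 x - y, which vanishes exactly on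
  -- slope m.
  have shift_vert : ∀ {m : F × F}, m.2 = 0 → ∀ v, shift r s (m.1 - r) v ∈ component r s none ↔
      v ∈ component r s (some m) := by
    intro m hm v
    rw [mem_component_none, mem_component_some, mul_of_snd_eq_zero _ hm, shift_apply]
    simp [sub_eq_zero, eq_comm]
  have shift_ne : ∀ {c : F} {v v'}, v ≠ v' → shift r s c v ≠ shift r s c v' :=
    fun h => (hf.shift_injective _).ne h
  have shift_ne0 : ∀ {c : F} {v}, v ≠ 0 → shift r s c v ≠ 0 := fun {c v} h => by
    simpa using shift_ne (c := c) h
  rcases d with _ | m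
  · exact vert ha ha0 hb hb0 hab (fun h => hw0 (hf.eq_zero_of_mem hde h hw))
  by_cases hm : m.2 = 0
  · refine hf.hasHexagon_of_shift (m.1 - r) (vert ((shift_vert hm a).2 ha) (shift_ne0 ha0)
      ((shift_vert hm b).2 hb) (shift_ne0 hb0) (shift_ne hab) ?_)
    rw [shift_vert hm]
    exact fun h => hw0 (hf.eq_zero_of_mem hde h hw)
  have right : ∀ {a b w : (F × F) × (F × F)}, a ∈ component r s (some m) → a ≠ 0 →
      b ∈ component r s (some m) → b ≠ 0 → a ≠ b → w ∈ component r s none → w ≠ 0 →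
      HasHexagon r s a b w := by
    intro a b w ha ha0 hb hb0 hab hw hw0
    obtain ⟨x, rfl⟩ := exists_param_eq ha
    obtain ⟨y, rfl⟩ := exists_param_eq hb
    refine hf.hasHexagon_of_right_vertical ht0 ht1 hm ?_ ?_ ?_ hw hw0
    · rintro rfl
      exact ha0 (map_zero _)
    · rintro rfl
      exact hb0 (map_zero _)
    · rintro rfl
      exact hab rfl
  rcases e with _ | n
  · exact right ha ha0 hb hb0 hab hw hw0
  by_cases hn : n.2 = 0
  · exact hf.hasHexagon_of_shift (n.1 - r) (right (shift_mem hm ha) (shift_ne0 ha0)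
      (shift_mem hm hb) (shift_ne0 hb0) (shift_ne hab) ((shift_vert hn w).2 hw) (shift_ne0 hw0))
  · exact hf.hasHexagon_of_nonscalar ht0 ht1 hm hn ha ha0 hb hb0 hab hw hw0

end Plane

end HallPlane

open HallPlane in
theorem theorem3 {F : Type*} [Field F] [Finite F] [DecidableEq F] (r s : F)
    (hf : Irreducible (Polynomial.X ^ 2 - Polynomial.C r * Polynomial.X - Polynomial.C s :
      Polynomial F))
    (l₁ l₂ : HallPlane.Line F) (hl : l₁ ≠ l₂)
    (A₁ B₁ : HallPlane.Point F) (hAB : A₁ ≠ B₁)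
    (hA₁ : HallPlane.Incident r s A₁ l₁) (hB₁ : HallPlane.Incident r s B₁ l₁)
    (hA₂ : ¬ HallPlane.Incident r s A₁ l₂) (hB₂ : ¬ HallPlane.Incident r s B₁ l₂) :
    ∃ C₁ A₂ B₂ C₂ : HallPlane.Point F,
      HallPlane.Incident r s C₁ l₁ ∧
      HallPlane.Incident r s A₂ l₂ ∧ HallPlane.Incident r s B₂ l₂ ∧
      HallPlane.Incident r s C₂ l₂ ∧
      HallPlane.IsPappus r s A₁ B₁ C₁ A₂ B₂ C₂ ∧
      (A₁.IsAffine → B₁.IsAffine → l₂ ≠ HallPlane.Line.infinity →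
        C₁.IsAffine ∧ A₂.IsAffine ∧ B₂.IsAffine ∧ C₂.IsAffine) := by
  replace hf := noRoot_of_irreducible hf
  rcases line_cases r s l₁ with ⟨d, v₀, rfl⟩ | rfl
  · rcases line_cases r s l₂ with ⟨e, v₁, rfl⟩ | rfl
    · by_cases hde : d = e
      · subst hde
        have hv : v₁ - v₀ ∉ component r s d := fun h => hl (line_eq_line h).symm
        rcases point_cases A₁ with ⟨a, rfl⟩ | ⟨g, rfl⟩
        · rcases point_cases B₁ with ⟨b, rfl⟩ | ⟨k, rfl⟩
          · obtain ⟨c, a', b', c', hc, ha', hb', hc', h⟩ := hf.exists_isPappus_of_parallel hv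
              (incident_pt_line.1 hA₁) (incident_pt_line.1 hB₁) (fun h => hAB (h ▸ rfl))
            exact ⟨_, _, _, _, hc, ha', hb', hc', h, fun _ _ _ =>
              ⟨isAffine_pt _, isAffine_pt _, isAffine_pt _, isAffine_pt _⟩⟩
          · exact absurd (incident_inf_line.2 (incident_inf_line.1 hB₁)) hB₂
        · exact absurd (incident_inf_line.2 (incident_inf_line.1 hA₁)) hA₂
      · obtain ⟨x, hx, y, hy, hxy⟩ := hf.exists_add hde (v₁ - v₀)
        -- The intersection point: v₀ + x = v₁ - y.
        obtain ⟨o, ho⟩ : ∃ o, o = v₀ + x := ⟨_, rfl⟩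
        have h₁ : line r s d v₀ = line r s d o := line_eq_line (by simpa [ho] using hx)
        have h₂ : line r s e v₁ = line r s e o := line_eq_line (by
          have : v₁ - o = y := by rw [ho, ← sub_sub, hxy, add_sub_cancel_left]
          rwa [this])
        rw [h₁] at hA₁ hB₁ ⊢
        rw [h₂] at hA₂ hB₂ ⊢
        have affine : ∀ a, Incident r s (pt a) (line r s d o) → ¬ Incident r s (pt a) (line r s e
            o) →
            ∃ b ∈ component r s d, b ≠ 0 ∧ a = o + b := fun a h h' =>
          ⟨a - o, incident_pt_line.1 h, fun h0 => h' (incident_pt_line.2 (by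
            rw [h0]; exact Submodule.zero_mem _)), by abel⟩
        rcases point_cases A₁ with ⟨a, rfl⟩ | ⟨g, rfl⟩
        · obtain ⟨a, ha, ha0, rfl⟩ := affine a hA₁ hA₂
          rcases point_cases B₁ with ⟨b, rfl⟩ | ⟨k, rfl⟩
          · obtain ⟨b, hb, hb0, rfl⟩ := affine b hB₁ hB₂
            obtain ⟨w, hw, hw0, -⟩ := exists_mem_ne (r := r) (s := s) e 0
            have hab : a ≠ b := fun h => hAB (by rw [h])
            obtain ⟨c, a', b', c', hc, ha', hb', hc', h⟩ :=
              hf.exists_isPappus_of_hasHexagon hde o ha ha0 hb hb0 hab hw hw0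
                (hf.hasHexagon hde ha ha0 hb hb0 hab hw hw0)
            exact ⟨_, _, _, _, hc, ha', hb', hc', h, fun _ _ _ =>
              ⟨isAffine_pt _, isAffine_pt _, isAffine_pt _, isAffine_pt _⟩⟩
          · obtain rfl := incident_inf_line.1 hB₁
            obtain ⟨c, b', c', hc, hb', hc', h⟩ :=
              hf.exists_isPappus_of_left_point_at_infinity hde o ha ha0
            exact ⟨_, _, _, _, hc, hb', incident_inf_line_self, hc', h.swap,
              fun _ h' => absurd h' (not_isAffine_inf _)⟩
        · obtain rfl := incident_inf_line.1 hA₁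
          rcases point_cases B₁ with ⟨b, rfl⟩ | ⟨k, rfl⟩
          · obtain ⟨b, hb, hb0, rfl⟩ := affine b hB₁ hB₂
            obtain ⟨c, b', c', hc, hb', hc', h⟩ :=
              hf.exists_isPappus_of_left_point_at_infinity hde o hb hb0
            exact ⟨_, _, _, _, hc, incident_inf_line_self, hb', hc', h,
              fun h' => absurd h' (not_isAffine_inf _)⟩
          · exact absurd (congrArg inf (incident_inf_line.1 hB₁).symm) hAB
    · rcases point_cases A₁ with ⟨a, rfl⟩ | ⟨g, rfl⟩
      · rcases point_cases B₁ with ⟨b, rfl⟩ | ⟨k, rfl⟩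
        · obtain ⟨c, e₁, e₂, e₃, hc, h⟩ := hf.exists_isPappus_of_right_eq_infinity
            (incident_pt_line.1 hA₁) (incident_pt_line.1 hB₁) (fun h => hAB (h ▸ rfl))
          exact ⟨_, _, _, _, hc, incident_inf_infinity, incident_inf_infinity,
            incident_inf_infinity, h, fun _ _ h' => absurd rfl h'⟩
        · exact absurd incident_inf_infinity hB₂
      · exact absurd incident_inf_infinity hA₂
  · rcases line_cases r s l₂ with ⟨e, v₁, rfl⟩ | rfl
    · rcases point_cases A₁ with ⟨a, rfl⟩ | ⟨g, rfl⟩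
      · exact absurd hA₁ not_incident_pt_infinity
      · rcases point_cases B₁ with ⟨b, rfl⟩ | ⟨k, rfl⟩
        · exact absurd hB₁ not_incident_pt_infinity
        · obtain ⟨e₃, a, b, c, ha, hb, hc, h⟩ := hf.exists_isPappus_of_left_eq_infinity v₁
            (fun h => hAB (congrArg inf h)) (fun h => hA₂ (incident_inf_line.2 h))
            (fun h => hB₂ (incident_inf_line.2 h))
          exact ⟨_, _, _, _, incident_inf_infinity, ha, hb, hc, h,
            fun h' => absurd h' (not_isAffine_inf _)⟩
    · exact absurd rfl hl
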